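/- For a finite group $G$ let $K(G)=\{x\in G : \langle x,g\rangle \text{ is cyclic for all } g\in G\}$, i.e. the set of universal vertices of the enhanced power graph of $G$ (vertex set $G\setminus\{1\}$, with $x,y$ joined when $\langle x,y\rangle$ is cyclic) together with the identity. Let $O_{2'}(G)$ be the largest normal subgroup of $G$ of odd order, and let $\widetilde{\mathrm{GL}}_2(3)$ denote the group of order $48$ that is isoclinic to $\mathrm{GL}_2(3)$ and has a generalized quaternion group of order $16$ as a Sylow $2$-subgroup. (Generalized quaternion groups are the groups $Q_{2^n}$, $n\ge 3$, including $Q_8$.) **Theorem.** Let $G$ be a finite solvable group, $p$ a prime and $P$ a Sylow $p$-subgroup of $G$. Then $p$ divides $|K(G)|$ if and only if one of the following occurs: 1. $P$ is cyclic and $Z(G)\cap P\neq 1$. 2. $p=2$ and one of the following occurs: - (a) $P$ is generalized quaternion, $G$ has a normal $2$-complement $Q$, and $Z(P)\le C_P(Q)$; - (b) $Z(P)\le C_P(O_{2'}(G))$ and $G/O_{2'}(G)$ is isomorphic to $\mathrm{SL}_2(3)$ or to $\widetilde{\mathrm{GL}}_2(3)$. Moreover, if (2)(b) occurs and $3$ divides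 $|K(G)|$, then $G/O_{2'}(G)\cong \mathrm{SL}_2(3)$; and if (2) occurs, then $|K(G)|_2=2$, where $|K(G)|_2$ is the largest power of $2$ dividing $|K(G)|$. -/

import Mathlib

open scoped commutatorElement

namespace EnhancedPower

/-- The set `K(G)` of all `x` such that `⟨x, g⟩` is cyclic for every `g`: the universal vertices of
the enhanced power graph of `G` together with the identity. -/
def K (G : Type*) [Group G] : Set G :=
  {x | ∀ g : G, IsCyclic (Subgroup.closure ({x, g} : Set G))}

/-- A generalized quaternion (2-)group: the group of order `4 * 2 ^ n` with `n ≥ 1`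
(so the quaternion group of order 8 is included and the cyclic group of order 4 is not). -/
def IsGeneralizedQuaternion (H : Type*) [Group H] : Prop :=
  ∃ n : ℕ, 1 ≤ n ∧ Nonempty (H ≃* QuaternionGroup (2 ^ n))

/-- `O_{p'}(G)`: the subgroup generated by all normal subgroups of order prime to `p`. -/
def pPrimeCore (p : ℕ) (G : Type*) [Group G] : Subgroup G :=
  sSup {N : Subgroup G | N.Normal ∧ (Nat.card N).Coprime p}

instance pPrimeCore_normal (p : ℕ) (G : Type*) [Group G] : (pPrimeCore p G).Normal := by
  exact Subgroup.sSup_normal _ fun _ h => h.1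

/-- Isoclinism of groups: isomorphisms of the central quotients and of the derived subgroups that
are compatible with the commutator maps. -/
def IsIsoclinic (G H : Type*) [Group G] [Group H] : Prop :=
  ∃ (φ : G ⧸ Subgroup.center G ≃* H ⧸ Subgroup.center H) (ψ : commutator G ≃* commutator H),
    ∀ (g₁ g₂ : G) (h₁ h₂ : H),
      φ (QuotientGroup.mk g₁) = QuotientGroup.mk h₁ →
      φ (QuotientGroup.mk g₂) = QuotientGroup.mk h₂ →
      ((ψ ⟨⁅g₁, g₂⁆, Subgroup.commutator_mem_commutator (Subgroup.mem_top g₁)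
        (Subgroup.mem_top g₂)⟩ : commutator H) : H) = ⁅h₁, h₂⁆

/-- `H` is (a copy of) the group of order 48 that is isoclinic to `GL₂(3)` and has
generalized quaternion Sylow 2-subgroups of order 16. -/
def IsTildeGL23 (H : Type*) [Group H] : Prop :=
  Nat.card H = 48 ∧ IsIsoclinic H (Matrix.GeneralLinearGroup (Fin 2) (ZMod 3)) ∧
    ∀ S : Sylow 2 H, IsGeneralizedQuaternion S ∧ Nat.card S = 16

/-- `Z(P)`, as a subgroup of `G`. -/
def centerOf {G : Type*} [Group G] (P : Subgroup G) : Subgroup G :=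
  (Subgroup.center P).map P.subtype

/-- `C_P(N)`, as a subgroup of `G`. -/
def centralizerIn {G : Type*} [Group G] (P N : Subgroup G) : Subgroup G :=
  P ⊓ Subgroup.centralizer (N : Set G)

/-- `P` is generalized quaternion, `G` has a normal complement `Q` to `P` (a normal 2-complement
when `P` is a Sylow 2-subgroup), and `Z(P) ≤ C_P(Q)`. -/
def QuaternionWithComplement {G : Type*} [Group G] (P : Subgroup G) : Prop :=
  IsGeneralizedQuaternion P ∧
    ∃ Q : Subgroup G, Q.Normal ∧ Q.IsComplement' P ∧ centerOf P ≤ centralizerIn P Q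

/-- `Z(P) ≤ C_P(O_{2'}(G))`, and `G / O_{2'}(G)` is `SL₂(3)` or the isoclinic variant of `GL₂(3)`
with generalized quaternion Sylow 2-subgroups. -/
def ExceptionalQuotient {G : Type*} [Group G] (P : Subgroup G) : Prop :=
  centerOf P ≤ centralizerIn P (pPrimeCore 2 G) ∧
    (Nonempty (G ⧸ pPrimeCore 2 G ≃* Matrix.SpecialLinearGroup (Fin 2) (ZMod 3)) ∨
      IsTildeGL23 (G ⧸ pPrimeCore 2 G))

end EnhancedPower

/-! `K(G)` is a central subgroup, and `p` divides its order exactly when `G` has a central subgroup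
`⟨x⟩` of order `p` containing every `y` with `y ^ p = 1` (`prime_dvd_card_K_iff`). Indeed, if `p`
divides the order of `g` then `⟨g⟩` already contains `x`; otherwise `x` and `g` commute and have
coprime orders, so `⟨x * g⟩` contains both.

A Sylow `p`-subgroup `P` then has one subgroup of order `p`, so it is cyclic, or `p = 2` and it is
generalised quaternion (`isCyclic_or_isGeneralizedQuaternion`). In the cyclic case a conjugation
argument finishes the equivalence.

In the quaternion case put `H = G / O_{2'}(G)` and let `N` be its largest normal 2-subgroup.
Solvability gives `C_H(N) ≤ N`, and `N` is cyclic or generalised quaternion. Unless `N` is `Q₈`,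
elements of odd order centralise `N`, hence lie in it and are trivial: `H` is a 2-group and
`O_{2'}(G)` is a complement to `P`. If `N` is `Q₈`, embed it in `GL₂(3)` and let `Γ ≤ H × GL₂(3)`
consist of the pairs acting alike on `N`. Both projections of `Γ` have kernel of order 2 and the
first is onto, so `|H|` divides 48. Orders 8 and 16 give 2-groups. For orders 24 and 48, `Γ`
contains a subgroup of order 24 on which both projections are injective. This identifies `H` with
`SL₂(3)` when `|H| = 24`; when `|H| = 48` it contains the derived subgroup of `Γ`, which makes `H`
isoclinic to `GL₂(3)`.

Conversely, an involution of `Z(P)` that centralises an odd-order normal subgroup `M` is the only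
involution of `G` as soon as `G / M` has a unique involution and it is central
(`exists_central_involution`). The center of `G / M` has order 2 in every case, which bounds the
2-part of `|K(G)|`. Finally, `PGL₂(3)` has an inverted element of order 3, which is incompatible
with a central element of order 3 in a cyclic Sylow 3-subgroup (`sq_eq_one_of_inverted`). -/

namespace EnhancedPower

/-! ### Elements normalising a cyclic p-group and having p-th power in it. -/

section CyclicIndexP

variable {P : Type*} [Group P]

theorem zpow_mul_comm_of_mul_eq {a x : P} {s : ℤ} (h : a * x = x * a ^ s) (j : ℤ) :
    a ^ j * x = x * a ^ (j * s) := by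
  have h1 : SemiconjBy x (a ^ s) a := h.symm
  have h2 := h1.zpow_right j
  rw [mul_comm, zpow_mul]
  exact h2.symm

theorem zpow_mul_pow_comm_of_mul_eq {a x : P} {s : ℤ} (h : a * x = x * a ^ s) (j : ℤ) (m : ℕ) :
    a ^ j * x ^ m = x ^ m * a ^ (j * s ^ m) := by
  induction m with
  | zero => simp
  | succ m ih =>
    rw [pow_succ, ← mul_assoc, ih, mul_assoc, zpow_mul_comm_of_mul_eq h, mul_assoc, pow_succ,
      mul_assoc]

theorem mul_zpow_pow_of_mul_eq {a x : P} {s : ℤ} (h : a * x = x * a ^ s) (j : ℤ) (m : ℕ) :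
    (x * a ^ j) ^ m = x ^ m * a ^ (j * ∑ i ∈ Finset.range m, s ^ i) := by
  induction m with
  | zero => simp
  | succ m ih =>
    rw [pow_succ', ih, mul_assoc, ← mul_assoc (a ^ j), zpow_mul_pow_comm_of_mul_eq h,
      Finset.sum_range_succ, pow_succ', mul_assoc, mul_assoc, ← zpow_add]
    ring_nf

theorem pow_dvd_mul_pow_sub_one {a x : P} {p n : ℕ} (ha : orderOf a = p ^ n) {s k : ℤ} {m : ℕ}
    (h : a * x = x * a ^ s) (hx : x ^ m = a ^ k) : (p : ℤ) ^ n ∣ s ^ m - 1 := by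
  have h1 := zpow_mul_pow_comm_of_mul_eq h 1 m
  rw [hx, ← zpow_add, ← zpow_add, zpow_eq_zpow_iff_modEq, ha, Int.modEq_iff_dvd] at h1
  push_cast at h1
  convert h1 using 1
  ring

/-- If every solution of `y ^ p = 1` lies in `⟨a⟩` then the geometric sum attached to the action
of `x` on `⟨a⟩` cannot be `p` times a unit. -/
theorem not_dvd_of_geom_sum {a x : P} {p n : ℕ} (ha : orderOf a = p ^ n)
    (hU : ∀ y : P, y ^ p = 1 → y ∈ Subgroup.zpowers a) (hxa : x ∉ Subgroup.zpowers a)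
    {s k u : ℤ} (h : a * x = x * a ^ s) (hx : x ^ p = a ^ k)
    (hs : ∑ i ∈ Finset.range p, s ^ i = p * u) (hu : IsCoprime u (p : ℤ)) : ¬ (p : ℤ) ∣ k := by
  rintro ⟨k', rfl⟩
  obtain ⟨v, w, hvw⟩ := (hu.pow_right (n := n))
  -- `v` inverts `u` modulo `p ^ n`, so the exponent `p * k' - k' * v * (p * u)` vanishes modulo the
  -- order of `a`.
  have key : (x * a ^ (-k' * v)) ^ p = 1 := by
    rw [mul_zpow_pow_of_mul_eq h, hx, hs, ← zpow_add, ← orderOf_dvd_iff_zpow_eq_one, ha]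
    push_cast
    refine ⟨p * k' * w, ?_⟩
    linear_combination (p : ℤ) * k' * (1 - 0) * (-hvw)
  have h2 := hU _ key
  exact hxa ((Subgroup.mul_mem_cancel_right _ (Subgroup.zpow_mem_zpowers a _)).1 h2)

/-- For odd `p` the sum is `p` modulo `p ^ 2`. For `p = 2` this breaks down when `s` is 3 modulo 4,
and that is how quaternion groups enter. -/
theorem exists_geom_sum_eq_of_odd {p : ℕ} [Fact p.Prime] (hp : Odd p) {s : ℤ}
    (hs : (p : ℤ) ∣ s - 1) :
    ∃ u : ℤ, ∑ i ∈ Finset.range p, s ^ i = p * u ∧ IsCoprime u (p : ℤ) := by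
  obtain ⟨m, hm⟩ := hs
  have h := odd_sq_dvd_geom_sum₂_sub (1 : ℤ) m hp
  obtain ⟨c, hc⟩ := h
  have hs' : s = 1 + p * m := by linarith
  refine ⟨1 + p * c, ?_, ⟨1, -c, by ring⟩⟩
  simp only [one_pow, mul_one] at hc
  rw [hs']
  linear_combination hc

/-- No `x * a ^ j` squares to 1, so `k + j * (1 + s)` is never zero modulo the order of `a`. The
case `s ≡ 1` modulo 4 is excluded by `not_dvd_of_geom_sum`, so `s - 1` is twice an odd number. Then
`s ^ 2 ≡ 1` and `k * s ≡ k` determine `s ≡ -1` and `k ≡ 0` up to the last binary digit, and `j = 1`,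
`j = 0` settle that digit. -/
theorem inverts_of_two {a x : P} {n : ℕ} (ha : orderOf a = 2 ^ n) (hn : 1 ≤ n)
    (hU : ∀ y : P, y ^ 2 = 1 → y ∈ Subgroup.zpowers a) (hxa : x ∉ Subgroup.zpowers a)
    {s k : ℤ} (h : a * x = x * a ^ s) (hx : x ^ 2 = a ^ k) (hk : (2 : ℤ) ∣ k) :
    2 ≤ n ∧ a * x = x * a⁻¹ ∧ x ^ 2 = a ^ (2 ^ (n - 1)) := by
  obtain ⟨n, rfl⟩ : ∃ m, n = m + 1 := ⟨n - 1, by omega⟩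
  have hd := pow_dvd_mul_pow_sub_one ha h hx
  push_cast at hd
  have hno : ∀ j : ℤ, ¬ (2 : ℤ) ^ (n + 1) ∣ k + j * (1 + s) := by
    intro j hj
    have key : (x * a ^ j) ^ 2 = 1 := by
      rw [mul_zpow_pow_of_mul_eq h, hx, ← zpow_add, ← orderOf_dvd_iff_zpow_eq_one, ha]
      simpa [Finset.sum_range_succ] using hj
    exact hxa ((Subgroup.mul_mem_cancel_right _ (Subgroup.zpow_mem_zpowers a _)).1 (hU _ key))
  have hodd : s % 2 = 1 := by
    have : (2 : ℤ) ∣ s ^ 2 - 1 := (dvd_pow_self 2 (by omega)).trans hd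
    rcases Int.emod_two_eq_zero_or_one s with h0 | h0
    · exfalso
      obtain ⟨t, ht⟩ : (2 : ℤ) ∣ s := Int.dvd_of_emod_eq_zero h0
      rw [ht] at this
      ring_nf at this
      omega
    · exact h0
  have hs4 : s % 4 = 3 := by
    by_contra hne
    have h1 : s % 4 = 1 := by omega
    refine not_dvd_of_geom_sum (p := 2) ha hU hxa (u := (1 + s) / 2) h hx ?_ ?_ (by exact_mod_cast hk)
    · simp [Finset.sum_range_succ]
      omega
    · rw [Int.isCoprime_iff_gcd_eq_one]
      have : ((1 + s) / 2) % 2 = 1 := by omega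
      have := Int.odd_iff.2 this
      simpa using (Int.isCoprime_iff_gcd_eq_one.1 (Int.isCoprime_two_right.2 this))
  have hn2 : 1 ≤ n := by
    by_contra h0
    have : n = 0 := by omega
    subst this
    apply hno 0
    simpa using hk
  obtain ⟨e, he⟩ : ∃ e, s - 1 = 2 * (2 * e + 1) := ⟨(s - 3) / 4, by omega⟩
  have hcop : IsCoprime ((2 : ℤ) ^ n) (2 * e + 1) := by
    apply IsCoprime.pow_left
    exact ⟨-e, 1, by ring⟩
  have hs1 : (2 : ℤ) ^ n ∣ s + 1 := by
    apply hcop.dvd_of_dvd_mul_left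
    have : (2 : ℤ) * 2 ^ n ∣ 2 * ((2 * e + 1) * (s + 1)) := by
      convert hd using 1
      · ring
      · linear_combination -(s + 1) * he
    exact (mul_dvd_mul_iff_left two_ne_zero).1 this
  have hk1 : (2 : ℤ) ^ n ∣ k := by
    apply hcop.dvd_of_dvd_mul_left
    -- `a ^ k = x ^ 2` commutes with `x`, which yields `k * s ≡ k`.
    have h1 : a ^ k * x = x * a ^ k := by rw [← hx]; exact ((Commute.refl x).pow_left 2)
    rw [zpow_mul_comm_of_mul_eq h, mul_left_cancel_iff, zpow_eq_zpow_iff_modEq, ha,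
      Int.modEq_iff_dvd] at h1
    have : (2 : ℤ) * 2 ^ n ∣ 2 * ((2 * e + 1) * k) := by
      rw [← dvd_neg] at h1
      push_cast at h1
      have h2 : 2 * ((2 * e + 1) * k) = -(k - k * s) := by linear_combination -k * he
      rw [h2, ← pow_succ']
      exact h1
    exact (mul_dvd_mul_iff_left two_ne_zero).1 this
  obtain ⟨c, hc⟩ := hs1
  obtain ⟨d, hd'⟩ := hk1
  have hdodd : d % 2 = 1 := by
    by_contra h0
    apply hno 0
    obtain ⟨t, ht⟩ : ∃ t, d = 2 * t := ⟨d / 2, by omega⟩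
    exact ⟨t, by rw [hd', ht]; ring⟩
  have hceven : c % 2 = 0 := by
    by_contra h0
    apply hno 1
    obtain ⟨t, ht⟩ : ∃ t, d + c = 2 * t := ⟨(d + c) / 2, by omega⟩
    refine ⟨t, ?_⟩
    rw [hd', add_comm 1 s, hc]
    linear_combination 2 ^ n * ht
  refine ⟨by omega, ?_, ?_⟩
  · rw [h, mul_left_cancel_iff, ← zpow_neg_one, zpow_eq_zpow_iff_modEq, ha, Int.modEq_iff_dvd]
    refine ⟨-(c / 2), ?_⟩
    obtain ⟨t, rfl⟩ : ∃ t, c = 2 * t := ⟨c / 2, by omega⟩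
    rw [Int.mul_ediv_cancel_left _ two_ne_zero]
    push_cast
    linear_combination -hc
  · rw [hx, ← zpow_natCast, zpow_eq_zpow_iff_modEq, ha, Int.modEq_iff_dvd]
    obtain ⟨t, rfl⟩ : ∃ t, d = 2 * t + 1 := ⟨d / 2, by omega⟩
    refine ⟨-t, ?_⟩
    push_cast
    rw [hd']
    ring

/-- An element `x` outside the cyclic group `⟨a⟩` that normalises it and has its `p`-th power
in it, in a group whose elements of order `p` all lie in `⟨a⟩`. -/
theorem generates_or_inverts {a x : P} {p n : ℕ} [hp : Fact p.Prime] (ha : orderOf a = p ^ n)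
    (hn : 1 ≤ n)
    (hU : ∀ y : P, y ^ p = 1 → y ∈ Subgroup.zpowers a) (hxa : x ∉ Subgroup.zpowers a)
    {s k : ℤ} (h : a * x = x * a ^ s) (hx : x ^ p = a ^ k) :
    a ∈ Subgroup.zpowers x ∨
      (p = 2 ∧ 2 ≤ n ∧ a * x = x * a⁻¹ ∧ x ^ 2 = a ^ (2 ^ (n - 1))) := by
  by_cases hk : (p : ℤ) ∣ k
  · right
    rcases hp.1.eq_two_or_odd' with rfl | hodd
    · exact ⟨rfl, inverts_of_two ha hn hU hxa h hx hk⟩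
    · exfalso
      have hd : (p : ℤ) ∣ s ^ p - 1 :=
        (dvd_pow_self _ (by omega)).trans (pow_dvd_mul_pow_sub_one ha h hx)
      have hs : (p : ℤ) ∣ s - 1 := by
        rw [← ZMod.intCast_zmod_eq_zero_iff_dvd] at hd ⊢
        push_cast at hd ⊢
        rwa [ZMod.pow_card] at hd
      obtain ⟨u, hu, hc⟩ := exists_geom_sum_eq_of_odd hodd hs
      exact not_dvd_of_geom_sum ha hU hxa h hx hu hc hk
  · left
    have hc : IsCoprime k ((p : ℤ) ^ n) :=
      (((Nat.prime_iff_prime_int.1 hp.1).coprime_iff_not_dvd.2 hk).symm).pow_right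
    obtain ⟨v, w, hvw⟩ := hc
    refine ⟨p * v, ?_⟩
    change x ^ ((p : ℤ) * v) = a
    rw [zpow_mul, zpow_natCast, hx, ← zpow_mul]
    conv_rhs => rw [← zpow_one a]
    rw [zpow_eq_zpow_iff_modEq, ha, Int.modEq_iff_dvd]
    push_cast
    exact ⟨w, by linear_combination -hvw⟩

end CyclicIndexP

/-! ### Central elements modulo a subgroup. -/

theorem exists_pow_prime_pow_mem {P : Type*} [Group P] {p : ℕ}
    (hP : IsPGroup p P) (A : Subgroup P) {y : P} (hy : y ∉ A) :
    ∃ m : ℕ, y ^ p ^ m ∉ A ∧ y ^ p ^ (m + 1) ∈ A := by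
  classical
  have hex : ∃ k, y ^ p ^ k ∈ A := by
    obtain ⟨k, hk⟩ := isPGroup_iff_pow_pow_eq_one.1 hP y
    exact ⟨k, by rw [hk]; exact A.one_mem⟩
  have h0 : Nat.find hex ≠ 0 := fun h => hy (by simpa [h] using Nat.find_spec hex)
  obtain ⟨m, hm⟩ := Nat.exists_eq_succ_of_ne_zero h0
  exact ⟨m, Nat.find_min hex (by omega), by simpa [hm] using Nat.find_spec hex⟩

/-- If a normal subgroup `C` of a finite `p`-group is not contained in `A`, then it contains an
element of order `p` modulo `A` that is central modulo `A`. -/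
theorem exists_mem_central_mod {P : Type*} [Group P] [Finite P] {p : ℕ} [Fact p.Prime]
    (hP : IsPGroup p P) (A C : Subgroup P) [C.Normal] (hCA : ¬ C ≤ A) :
    ∃ y ∈ C, y ∉ A ∧ y ^ p ∈ A ∧ ∀ g : P, y * g * y⁻¹ * g⁻¹ ∈ A := by
  classical
  obtain ⟨n, H, ⟨hH0, hHs⟩, hHn⟩ :=
    (Subgroup.nilpotent_iff_finite_descending_central_series P).1 hP.isNilpotent
  -- Take the last term of the descending central series whose intersection with `C` is not inside
  -- `A`: commutators of its elements fall into the next term, hence into `A`.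
  have hex : ∃ k, C ⊓ H k ≤ A := ⟨n, by simp [hHn]⟩
  have h0 : Nat.find hex ≠ 0 := fun h => hCA (by simpa [h, hH0] using Nat.find_spec hex)
  obtain ⟨k, hk⟩ := Nat.exists_eq_succ_of_ne_zero h0
  have hk1 : ¬ C ⊓ H k ≤ A := Nat.find_min hex (by omega)
  have hk2 : C ⊓ H (k + 1) ≤ A := by simpa [hk] using Nat.find_spec hex
  obtain ⟨y, hy, hyA⟩ := SetLike.not_le_iff_exists.1 hk1
  obtain ⟨m, hm1, hm2⟩ := exists_pow_prime_pow_mem hP A hyA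
  have hz : y ^ p ^ m ∈ C ⊓ H k := pow_mem hy _
  refine ⟨y ^ p ^ m, hz.1, hm1, by rwa [← pow_mul, ← pow_succ], fun g => hk2 ⟨?_, ?_⟩⟩
  · rw [mul_assoc, mul_assoc, ← mul_assoc g]
    exact C.mul_mem hz.1 (‹C.Normal›.conj_mem _ (C.inv_mem hz.1) g)
  · exact hHs _ _ hz.2 g

/-! ### Generalised quaternion groups and p-groups with one subgroup of order p. -/

section Quaternion

open QuaternionGroup

variable {P : Type*} [Group P]

/-- The universal property of the generalised quaternion groups. -/
noncomputable def quaternionLift (N : ℕ) (a x : P) (ha : a ^ (2 * N) = 1) (h : a * x = x * a⁻¹)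
    (hx : x ^ 2 = a ^ N) : QuaternionGroup N →* P :=
  let e : ZMod (2 * N) →+ Additive P := ZMod.lift (2 * N) ⟨zmultiplesHom _ (Additive.ofMul a), by
    rw [zmultiplesHom_apply, natCast_zsmul, ← ofMul_pow, ha, ofMul_one]⟩
  have he : ∀ i : ℤ, (e i).toMul = a ^ i := fun i => by
    simp only [e, ZMod.lift_coe, zmultiplesHom_apply]
    rfl
  MonoidHom.mk' (fun q => match q with
    | .a i => (e i).toMul
    | .xa i => x * (e i).toMul) (by
    have hc : ∀ j : ℤ, a ^ j * x = x * a ^ (-j) := fun j => by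
      have := zpow_mul_comm_of_mul_eq (a := a) (x := x) (s := -1) (by simpa using h) j
      simpa using this
    rintro (i | i) (j | j) <;> obtain ⟨i, rfl⟩ := ZMod.intCast_surjective i <;>
      obtain ⟨j, rfl⟩ := ZMod.intCast_surjective j
    · rw [a_mul_a, ← Int.cast_add]
      simp only [he, zpow_add]
    · rw [a_mul_xa, ← Int.cast_sub]
      simp only [he]
      rw [← mul_assoc, hc, mul_assoc, ← zpow_add]
      ring_nf
    · rw [xa_mul_a, ← Int.cast_add]
      simp only [he]
      rw [mul_assoc, ← zpow_add]
    · rw [xa_mul_xa, ← Int.cast_natCast, ← Int.cast_add, ← Int.cast_sub]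
      simp only [he]
      rw [mul_assoc, ← mul_assoc (a ^ i), hc, ← mul_assoc, ← mul_assoc, ← sq, hx, mul_assoc,
        ← zpow_natCast, ← zpow_add, ← zpow_add]
      ring_nf)

theorem quaternionLift_a (N : ℕ) (a x : P) (ha : a ^ (2 * N) = 1) (h : a * x = x * a⁻¹)
    (hx : x ^ 2 = a ^ N) (i : ℤ) :
    quaternionLift N a x ha h hx (QuaternionGroup.a i) = a ^ i := by
  change Additive.toMul ((ZMod.lift (2 * N) _) (i : ZMod (2 * N))) = _
  rw [ZMod.lift_coe]
  rfl

theorem quaternionLift_xa (N : ℕ) (a x : P) (ha : a ^ (2 * N) = 1) (h : a * x = x * a⁻¹)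
    (hx : x ^ 2 = a ^ N) (i : ℤ) :
    quaternionLift N a x ha h hx (QuaternionGroup.xa i) = x * a ^ i := by
  change x * Additive.toMul ((ZMod.lift (2 * N) _) (i : ZMod (2 * N))) = _
  rw [ZMod.lift_coe]
  rfl

theorem quaternionLift_bijective {N : ℕ} {a x : P} (ha : orderOf a = 2 * N)
    (h : a * x = x * a⁻¹) (hx : x ^ 2 = a ^ N) (hxa : x ∉ Subgroup.zpowers a)
    (hP : ∀ y ∉ Subgroup.zpowers a, x⁻¹ * y ∈ Subgroup.zpowers a) :
    Function.Bijective (quaternionLift N a x (by rw [← ha, pow_orderOf_eq_one]) h hx) := by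
  constructor
  · rw [injective_iff_map_eq_one]
    rintro (i | i) hi <;> obtain ⟨i, rfl⟩ := ZMod.intCast_surjective i
    · rw [quaternionLift_a, ← orderOf_dvd_iff_zpow_eq_one, ha] at hi
      rw [(ZMod.intCast_zmod_eq_zero_iff_dvd i (2 * N)).2 hi]
      rfl
    · rw [quaternionLift_xa, mul_eq_one_iff_eq_inv, ← zpow_neg] at hi
      exact absurd ⟨_, hi.symm⟩ hxa
  · intro y
    by_cases hy : y ∈ Subgroup.zpowers a
    · obtain ⟨i, rfl⟩ := hy
      exact ⟨.a i, quaternionLift_a ..⟩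
    · obtain ⟨i, hi⟩ := hP y hy
      refine ⟨.xa i, ?_⟩
      rw [quaternionLift_xa]
      change a ^ i = _ at hi
      rw [hi, mul_inv_cancel_left]

end Quaternion

/-- A finite `p`-group with only one subgroup of order `p` is cyclic or generalised quaternion. -/
theorem isCyclic_or_isGeneralizedQuaternion {P : Type*} [Group P] [Finite P] {p : ℕ}
    [hp : Fact p.Prime] (hP : IsPGroup p P)
    (hU : ∀ x y : P, x ^ p = 1 → x ≠ 1 → y ^ p = 1 → y ∈ Subgroup.zpowers x) :
    IsCyclic P ∨ (p = 2 ∧ IsGeneralizedQuaternion P) := by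
  rcases subsingleton_or_nontrivial P with hs | hnt
  · left; infer_instance
  -- a maximal normal cyclic subgroup `⟨a⟩`
  obtain ⟨c, hcC, hc1, hcp, hcc⟩ :=
    exists_mem_central_mod hP ⊥ (Subgroup.center P) (by
      have := hP.bot_lt_center
      exact fun h => this.ne' (le_bot_iff.1 h))
  rw [Subgroup.mem_bot] at hc1 hcp
  have hcS : Subgroup.zpowers c ∈ {A : Subgroup P | A.Normal ∧ ∃ a, A = Subgroup.zpowers a} := by
    refine ⟨⟨?_⟩, c, rfl⟩
    rintro _ ⟨k, rfl⟩ g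
    have := (Subgroup.mem_center_iff.1 ((Subgroup.center P).zpow_mem hcC k)) g
    change g * c ^ k * g⁻¹ ∈ _
    rw [this, mul_inv_cancel_right]
    exact ⟨k, rfl⟩
  obtain ⟨A, hcA, ⟨hAn, a, rfl⟩, hmax⟩ := Set.Finite.exists_le_maximal (Set.toFinite _) hcS
  have hUa : ∀ y : P, y ^ p = 1 → y ∈ Subgroup.zpowers a := fun y hy => hcA (hU c y hcp hc1 hy)
  obtain ⟨n, hn⟩ := (IsPGroup.iff_orderOf.1 hP) a
  have hn1 : 1 ≤ n := by
    by_contra h0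
    have : n = 0 := by omega
    subst this
    rw [pow_zero, orderOf_eq_one_iff] at hn
    subst hn
    exact hc1 (by simpa using hcA (Subgroup.mem_zpowers c))
  have hact : ∀ x : P, ∃ s : ℤ, a * x = x * a ^ s := fun x => by
    obtain ⟨s, hs⟩ := hAn.conj_mem a (Subgroup.mem_zpowers a) x⁻¹
    refine ⟨s, ?_⟩
    change a ^ s = _ at hs
    rw [hs]; group
  -- `⟨a⟩` is its own centralizer. Otherwise some `y` commuting with `a` is central of order `p`
  -- modulo `⟨a⟩`. Either `⟨y⟩` contains `⟨a⟩`, and is then normal and strictly larger, against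
  -- maximality; or `y` inverts as well as centralises `a`, so `a ^ 2 = 1`, against `2 ≤ n`.
  have hcent : ∀ y : P, a * y = y * a → y ∈ Subgroup.zpowers a := by
    by_contra! hcon
    obtain ⟨y₀, hy₀, hy₀A⟩ := hcon
    have hCn : (Subgroup.centralizer (Subgroup.zpowers a : Set P)).Normal := inferInstance
    obtain ⟨y, hyC, hyA, ⟨k, hk⟩, hyc⟩ := exists_mem_central_mod hP (Subgroup.zpowers a)
      (Subgroup.centralizer (Subgroup.zpowers a : Set P)) (fun hle => hy₀A (hle (by
        rw [Subgroup.mem_centralizer_iff]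
        rintro _ ⟨k, rfl⟩
        exact ((show Commute a y₀ from hy₀).zpow_left k).eq)))
    have hay : a * y = y * a := Subgroup.mem_centralizer_iff.1 hyC a (Subgroup.mem_zpowers a)
    rcases generates_or_inverts (s := 1) hn hn1 hUa hyA (by simpa using hay) hk.symm with h | h
    · have hle : Subgroup.zpowers a ≤ Subgroup.zpowers y := by simpa using h
      refine hyA (hmax (y := Subgroup.zpowers y) ⟨⟨?_⟩, y, rfl⟩ hle (Subgroup.mem_zpowers y))
      rintro _ ⟨k, rfl⟩ g
      change g * y ^ k * g⁻¹ ∈ _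
      rw [← conj_zpow]
      apply zpow_mem
      have h1 := hle (inv_mem (hyc g))
      have := mul_mem h1 (Subgroup.mem_zpowers y)
      convert this using 1
      group
    · obtain ⟨rfl, hn2, h3, -⟩ := h
      rw [hay, mul_left_cancel_iff, eq_inv_iff_mul_eq_one, ← sq] at h3
      have := Nat.le_of_dvd (by norm_num) (hn ▸ orderOf_dvd_of_pow_eq_one h3)
      have := Nat.pow_le_pow_right (n := 2) (by norm_num) hn2
      omega
  have hinv : ∀ x ∉ Subgroup.zpowers a, x ^ p ∈ Subgroup.zpowers a →
      (p = 2 ∧ 2 ≤ n ∧ a * x = x * a⁻¹ ∧ x ^ 2 = a ^ (2 ^ (n - 1))) := by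
    rintro x hx ⟨k, hk⟩
    obtain ⟨s, hs⟩ := hact x
    rcases generates_or_inverts hn hn1 hUa hx hs hk.symm with ⟨j, hj⟩ | h
    · refine absurd (hcent x ?_) hx
      change x ^ j = a at hj
      rw [← hj]
      exact ((Commute.refl x).zpow_left j).eq
    · exact h
  by_cases hall : ∀ x : P, x ∈ Subgroup.zpowers a
  · left; exact ⟨a, hall⟩
  right
  push Not at hall
  obtain ⟨x₀, hx₀⟩ := hall
  obtain ⟨m, hm1, hm2⟩ := exists_pow_prime_pow_mem hP _ hx₀
  set x := x₀ ^ p ^ m with hxdef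
  obtain ⟨rfl, hn2, hxinv, hx2⟩ := hinv x hm1 (by rwa [hxdef, ← pow_mul, ← pow_succ])
  refine ⟨rfl, n - 1, by omega, ?_⟩
  have hyinv : ∀ y ∉ Subgroup.zpowers a, a * y = y * a⁻¹ := by
    intro y hy
    obtain ⟨m, hm1, hm2⟩ := exists_pow_prime_pow_mem hP _ hy
    obtain ⟨-, -, h3, -⟩ := hinv (y ^ 2 ^ m) hm1 (by rwa [← pow_mul, ← pow_succ])
    rcases m with _ | m
    · simpa using h3
    -- Here a square acts on `⟨a⟩` as inversion, so `s ^ 2 ≡ -1` modulo `2 ^ n` and hence modulo 4,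
    -- which is impossible.
    · exfalso
      obtain ⟨s, hs⟩ := hact (y ^ 2 ^ m)
      have h4 := zpow_mul_pow_comm_of_mul_eq hs 1 2
      rw [← pow_mul, ← pow_succ, zpow_one, h3, mul_left_cancel_iff, ← zpow_neg_one,
        zpow_eq_zpow_iff_modEq, hn, Int.modEq_iff_dvd] at h4
      have h5 : (4 : ℤ) ∣ s ^ 2 + 1 := by
        have : (4 : ℤ) ∣ 2 ^ n := by
          obtain ⟨t, rfl⟩ : ∃ t, n = 2 + t := ⟨n - 2, by omega⟩
          exact ⟨2 ^ t, by rw [pow_add]; norm_num⟩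
        refine this.trans ?_
        rw [show s ^ 2 + 1 = 1 * s ^ 2 - -1 by ring]
        exact_mod_cast h4
      rcases Int.even_or_odd' s with ⟨t, rfl | rfl⟩ <;> ring_nf at h5 <;> omega
  have ha2 : orderOf a = 2 * 2 ^ (n - 1) := by
    rw [hn, ← pow_succ']
    congr 1; omega
  refine ⟨(MulEquiv.ofBijective _ (quaternionLift_bijective ha2 hxinv hx2 hm1 ?_)).symm⟩
  intro y hy
  -- Both `x` and `y` invert `a`, so `x⁻¹ * y` centralises it.
  apply hcent
  have h1 := hyinv y hy
  have h2 : a * x⁻¹ = x⁻¹ * a⁻¹ := by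
    have : x * a = a⁻¹ * x := by
      rw [eq_inv_mul_iff_mul_eq, ← mul_assoc, hxinv, mul_assoc, inv_mul_cancel, mul_one]
    rw [mul_inv_eq_iff_eq_mul, mul_assoc, ← this, inv_mul_cancel_left]
  rw [← mul_assoc, h2, mul_assoc]
  have h3 : a⁻¹ * y = y * a := by
    rw [inv_mul_eq_iff_eq_mul, ← mul_assoc, h1, mul_assoc, inv_mul_cancel, mul_one]
  rw [h3, mul_assoc]

/-! ### The subgroup `K(G)` and its prime divisors. -/

section Cyclicizer

variable {G : Type*} [Group G]

/-- A cyclic group has at most `p` solutions of `z ^ p = 1`, and the powers of `x` already supply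
`p` of them. -/
theorem mem_zpowers_of_isCyclic_of_pow_eq_one {C : Type*} [Group C] [Finite C] [IsCyclic C] {p : ℕ}
    [hp : Fact p.Prime] {x y : C} (hx : x ^ p = 1) (hx1 : x ≠ 1) (hy : y ^ p = 1) :
    y ∈ Subgroup.zpowers x := by
  classical
  have := Fintype.ofFinite C
  have hsub : (Finset.univ.filter fun z => z ∈ Subgroup.zpowers x) ⊆
      Finset.univ.filter fun z : C => z ^ p = 1 := by
    intro z hz
    simp only [Finset.mem_filter, Finset.mem_univ, true_and] at hz ⊢
    obtain ⟨k, rfl⟩ := hz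
    change (x ^ k) ^ p = 1
    rw [← zpow_natCast, ← zpow_mul, mul_comm, zpow_mul, zpow_natCast, hx, one_zpow]
  have hcard : (Finset.univ.filter fun z => z ∈ Subgroup.zpowers x).card = p := by
    rw [← orderOf_eq_prime hx hx1, ← Nat.card_zpowers, ← Fintype.card_subtype,
      ← Nat.card_eq_fintype_card]
  have heq := Finset.eq_of_subset_of_card_le hsub
    ((IsCyclic.card_pow_eq_one_le hp.1.pos).trans hcard.ge)
  have : y ∈ Finset.univ.filter fun z : C => z ^ p = 1 := by simp [hy]
  rw [← heq] at this
  simpa using this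

theorem mem_zpowers_symm_of_pow_eq_one [Finite G] {p : ℕ} [hp : Fact p.Prime] {x y : G}
    (hx : x ^ p = 1) (hy1 : y ≠ 1) (hy : y ∈ Subgroup.zpowers x) : x ∈ Subgroup.zpowers y := by
  have hx1 : x ≠ 1 := by
    rintro rfl
    exact hy1 (by simpa using hy)
  have hyp : y ^ p = 1 := by
    obtain ⟨k, rfl⟩ := hy
    change (x ^ k) ^ p = 1
    rw [← zpow_natCast, ← zpow_mul, mul_comm, zpow_mul, zpow_natCast, hx, one_zpow]
  have hle : Subgroup.zpowers y ≤ Subgroup.zpowers x := by simpa using hy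
  rw [Subgroup.eq_of_le_of_card_ge hle (by
    rw [Nat.card_zpowers, Nat.card_zpowers, orderOf_eq_prime hx hx1, orderOf_eq_prime hyp hy1])]
  exact Subgroup.mem_zpowers x

theorem mem_K_iff {x : G} :
    x ∈ K G ↔ ∀ g : G, ∃ h : G, x ∈ Subgroup.zpowers h ∧ g ∈ Subgroup.zpowers h := by
  constructor
  · intro hx g
    obtain ⟨h, hh⟩ := (Subgroup.isCyclic_iff_exists_zpowers_eq_top _).1 (hx g)
    exact ⟨h, hh ▸ Subgroup.subset_closure (by simp), hh ▸ Subgroup.subset_closure (by simp)⟩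
  · intro hx g
    obtain ⟨h, h1, h2⟩ := hx g
    have hle : Subgroup.closure {x, g} ≤ Subgroup.zpowers h := by
      rw [Subgroup.closure_le]
      rintro _ (rfl | rfl)
      exacts [h1, h2]
    exact Subgroup.isCyclic_of_le hle

variable (G) in
/-- `K(G)` as a subgroup. -/
def cyclicizer : Subgroup G where
  carrier := K G
  one_mem' := mem_K_iff.2 fun g => ⟨g, Subgroup.one_mem _, Subgroup.mem_zpowers g⟩
  inv_mem' := by
    intro x hx
    rw [mem_K_iff] at hx ⊢
    intro g
    obtain ⟨h, h1, h2⟩ := hx g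
    exact ⟨h, Subgroup.inv_mem _ h1, h2⟩
  mul_mem' := by
    intro x y hx hy
    rw [mem_K_iff] at hx hy ⊢
    intro g
    -- Apply the condition on `x` to a generator `h` of a cyclic group containing `y` and `g`, not
    -- to `g` itself.
    obtain ⟨h, h1, h2⟩ := hy g
    obtain ⟨k, h3, h4⟩ := hx h
    have hle : Subgroup.zpowers h ≤ Subgroup.zpowers k := by simpa using h4
    exact ⟨k, Subgroup.mul_mem _ h3 (hle h1), hle h2⟩

theorem cyclicizer_le_center : cyclicizer G ≤ Subgroup.center G := by
  intro x hx
  rw [Subgroup.mem_center_iff]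
  intro g
  obtain ⟨h, ⟨i, rfl⟩, ⟨j, rfl⟩⟩ := mem_K_iff.1 hx g
  exact ((Commute.refl h).zpow_zpow j i).eq

theorem card_K : Nat.card (K G) = Nat.card (cyclicizer G) := rfl

/-- Reduces the whole problem to the existence of a unique subgroup of order `p` that is moreover
central; the graph plays no role afterwards. -/
theorem prime_dvd_card_K_iff [Finite G] {p : ℕ} [hp : Fact p.Prime] :
    p ∣ Nat.card (K G) ↔ ∃ x ∈ Subgroup.center G, x ≠ 1 ∧ x ^ p = 1 ∧
      ∀ y : G, y ^ p = 1 → y ∈ Subgroup.zpowers x := by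
  rw [card_K]
  constructor
  · intro h
    obtain ⟨⟨x, hxK⟩, hx⟩ := exists_prime_orderOf_dvd_card' p h
    rw [Subgroup.orderOf_mk] at hx
    have hxp : x ^ p = 1 := by rw [← hx, pow_orderOf_eq_one]
    have hx1 : x ≠ 1 := by
      rintro rfl
      exact hp.1.one_lt.ne (by simpa using hx)
    refine ⟨x, cyclicizer_le_center hxK, hx1, hxp, fun y hy => ?_⟩
    obtain ⟨h, h1, h2⟩ := mem_K_iff.1 hxK y
    obtain ⟨k, hk⟩ := mem_zpowers_of_isCyclic_of_pow_eq_one (C := Subgroup.zpowers h) (p := p)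
      (x := ⟨x, h1⟩) (y := ⟨y, h2⟩) (Subtype.ext hxp) (fun h => hx1 (congrArg Subtype.val h))
      (Subtype.ext hy)
    exact ⟨k, congrArg Subtype.val hk⟩
  · rintro ⟨x, hxc, hx1, hxp, hx⟩
    have hox := orderOf_eq_prime hxp hx1
    have hxK : x ∈ cyclicizer G := by
      refine mem_K_iff.2 fun g => ?_
      by_cases hpg : p ∣ orderOf g
      · obtain ⟨m, hm⟩ := hpg
        have hz1 : g ^ m ≠ 1 := by
          intro h
          have := orderOf_dvd_of_pow_eq_one h
          have hm0 : m ≠ 0 := by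
            rintro rfl
            exact (orderOf_pos g).ne' (by simpa using hm)
          have := Nat.le_of_dvd (Nat.pos_of_ne_zero hm0) this
          have := hp.1.two_le
          nlinarith [Nat.pos_of_ne_zero hm0]
        have hzp : (g ^ m) ^ p = 1 := by rw [← pow_mul, mul_comm, ← hm, pow_orderOf_eq_one]
        refine ⟨g, ?_, Subgroup.mem_zpowers g⟩
        obtain ⟨k, hk⟩ := mem_zpowers_symm_of_pow_eq_one hxp hz1 (hx _ hzp)
        rw [← hk]
        exact zpow_mem (Subgroup.npow_mem_zpowers g m) k
      · have hcop : (orderOf g).gcd (orderOf x) = 1 := by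
          rw [hox]
          exact ((Nat.Prime.coprime_iff_not_dvd hp.1).2 hpg).symm
        have hc : Commute x g := ((Subgroup.mem_center_iff.1 hxc) g).symm
        -- Raising `x * g` to the order of `g` leaves a power of `x` with exponent prime to `p`,
        -- which generates `⟨x⟩`.
        have h1 : x ∈ Subgroup.zpowers (x * g) := by
          have h2 := mem_zpowers_pow_iff.2 hcop
          have h3 : x ^ orderOf g = (x * g) ^ orderOf g := by
            rw [hc.mul_pow, pow_orderOf_eq_one, mul_one]
          rw [h3] at h2
          have hle : Subgroup.zpowers ((x * g) ^ orderOf g) ≤ Subgroup.zpowers (x * g) := by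
            rw [Subgroup.zpowers_le]
            exact Subgroup.npow_mem_zpowers _ _
          exact hle h2
        exact ⟨x * g, h1, (Subgroup.mul_mem_cancel_left _ h1).1 (Subgroup.mem_zpowers _)⟩
    rw [← hox, ← Subgroup.orderOf_mk (H := cyclicizer G) x hxK]
    exact orderOf_dvd_natCard _

end Cyclicizer

/-! ### The involution of a generalised quaternion group. -/

section QuaternionFacts

theorem QuaternionGroup.eq_zero_or_eq_of_add_self {N : ℕ} {i : ZMod (2 * N)} (h : i + i = 0) :
    i = 0 ∨ i = N := by
  obtain ⟨i, rfl⟩ := ZMod.intCast_surjective i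
  rw [← Int.cast_add, ZMod.intCast_zmod_eq_zero_iff_dvd] at h
  obtain ⟨c, hc⟩ := h
  push_cast at hc
  have hi : i = N * c := by linarith
  rcases Int.even_or_odd' c with ⟨d, rfl | rfl⟩
  · left
    rw [ZMod.intCast_zmod_eq_zero_iff_dvd]
    exact ⟨d, by push_cast; rw [hi]; ring⟩
  · right
    rw [← Int.cast_natCast, ZMod.intCast_eq_intCast_iff_dvd_sub]
    exact ⟨-d, by push_cast; rw [hi]; ring⟩

/-- The involution is `a N` with `N = 2 ^ n`: each `xa i` squares to it, and an `a i` that squares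
to 1 or commutes with `xa 0` satisfies `i + i = 0`. -/
theorem IsGeneralizedQuaternion.exists_involution {H : Type*} [Group H]
    (h : IsGeneralizedQuaternion H) : ∃ z : H, z ≠ 1 ∧ z ^ 2 = 1 ∧ z ∈ Subgroup.center H ∧
      (∀ y : H, y ^ 2 = 1 → y = 1 ∨ y = z) ∧ ∀ y ∈ Subgroup.center H, y = 1 ∨ y = z := by
  obtain ⟨n, hn, ⟨e⟩⟩ := h
  set N := 2 ^ n with hN
  have hN2 : 2 ≤ N := by
    rw [hN]
    calc 2 = 2 ^ 1 := rfl
      _ ≤ 2 ^ n := Nat.pow_le_pow_right (by norm_num) hn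
  have hNN : (N : ZMod (2 * N)) + N = 0 := by
    rw [← Nat.cast_add, ← two_mul, ZMod.natCast_self]
  have hN0 : (N : ZMod (2 * N)) ≠ 0 := by
    rw [Ne, ZMod.natCast_eq_zero_iff]
    intro h
    have := Nat.le_of_dvd (by omega) h
    omega
  have h20 : (1 : ZMod (2 * N)) + 1 ≠ 0 := by
    have : ((2 : ℕ) : ZMod (2 * N)) ≠ 0 := by
      rw [Ne, ZMod.natCast_eq_zero_iff]
      intro h
      have := Nat.le_of_dvd (by omega) h
      omega
    rw [one_add_one_eq_two]
    exact_mod_cast this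
  have key : ∀ i : ZMod (2 * N), i + i = 0 →
      (QuaternionGroup.a i = 1 ∨ QuaternionGroup.a i = QuaternionGroup.a (N : ZMod (2 * N))) := by
    intro i hi
    rcases QuaternionGroup.eq_zero_or_eq_of_add_self hi with rfl | rfl
    · left; rfl
    · right; rfl
  have hsq : ∀ q : QuaternionGroup N, q ^ 2 = 1 →
      q = 1 ∨ q = QuaternionGroup.a (N : ZMod (2 * N)) := by
    rintro (i | i) hq
    · rw [sq, QuaternionGroup.a_mul_a, QuaternionGroup.one_def, QuaternionGroup.a.injEq] at hq
      exact key i hq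
    · rw [QuaternionGroup.xa_sq, QuaternionGroup.one_def, QuaternionGroup.a.injEq] at hq
      exact absurd hq hN0
  have hcen : ∀ q ∈ Subgroup.center (QuaternionGroup N),
      q = 1 ∨ q = QuaternionGroup.a (N : ZMod (2 * N)) := by
    rintro (i | i) hq
    · have := Subgroup.mem_center_iff.1 hq (.xa 0)
      rw [QuaternionGroup.xa_mul_a, QuaternionGroup.a_mul_xa, QuaternionGroup.xa.injEq,
        zero_add, zero_sub, eq_neg_iff_add_eq_zero] at this
      exact key i this
    · have := Subgroup.mem_center_iff.1 hq (.a 1)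
      rw [QuaternionGroup.xa_mul_a, QuaternionGroup.a_mul_xa, QuaternionGroup.xa.injEq] at this
      exact absurd (by linear_combination -this) h20
  have hzc : QuaternionGroup.a (N : ZMod (2 * N)) ∈ Subgroup.center (QuaternionGroup N) := by
    rw [Subgroup.mem_center_iff]
    rintro (i | i)
    · rw [QuaternionGroup.a_mul_a, QuaternionGroup.a_mul_a, add_comm]
    · rw [QuaternionGroup.xa_mul_a, QuaternionGroup.a_mul_xa, QuaternionGroup.xa.injEq]
      linear_combination hNN
  refine ⟨e.symm (.a N), ?_, ?_, ?_, ?_, ?_⟩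
  · rw [Ne, MulEquiv.map_eq_one_iff, QuaternionGroup.one_def, QuaternionGroup.a.injEq]
    exact hN0
  · rw [← map_pow, sq, QuaternionGroup.a_mul_a, hNN, ← QuaternionGroup.one_def, map_one]
  · rw [Subgroup.mem_center_iff]
    intro g
    apply e.injective
    simpa using Subgroup.mem_center_iff.1 hzc (e g)
  · intro y hy
    have := hsq (e y) (by rw [← map_pow, hy, map_one])
    simpa [MulEquiv.eq_symm_apply] using this
  · intro y hy
    have : e y ∈ Subgroup.center (QuaternionGroup N) := by
      rw [Subgroup.mem_center_iff]
      intro g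
      apply e.symm.injective
      simpa using Subgroup.mem_center_iff.1 hy (e.symm g)
    simpa [MulEquiv.eq_symm_apply] using hcen _ this

theorem IsGeneralizedQuaternion.congr {H H' : Type*} [Group H] [Group H'] (e : H ≃* H')
    (h : IsGeneralizedQuaternion H) : IsGeneralizedQuaternion H' := by
  obtain ⟨n, hn, ⟨f⟩⟩ := h
  exact ⟨n, hn, ⟨e.symm.trans f⟩⟩

end QuaternionFacts

/-! ### The p'-core. -/

section PPrimeCore

variable {G : Type*} [Group G] [Finite G] {p : ℕ}

theorem coprime_card_iff [hp : Fact p.Prime] (N : Subgroup G) :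
    (Nat.card N).Coprime p ↔ ∀ x ∈ N, x ^ p = 1 → x = 1 := by
  rw [Nat.coprime_comm, Nat.Prime.coprime_iff_not_dvd hp.1]
  constructor
  · intro h x hx hxp
    by_contra hx1
    apply h
    rw [← orderOf_eq_prime hxp hx1, ← Subgroup.orderOf_mk (H := N) x hx]
    exact orderOf_dvd_natCard _
  · intro h hd
    obtain ⟨⟨x, hxN⟩, hx⟩ := exists_prime_orderOf_dvd_card' p hd
    rw [Subgroup.orderOf_mk] at hx
    have := h x hxN (by rw [← hx, pow_orderOf_eq_one])
    subst this
    exact hp.1.one_lt.ne (by simpa using hx)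

theorem coprime_card_comap [hp : Fact p.Prime] {G' : Type*} [Group G'] [Finite G'] (f : G →* G')
    {N : Subgroup G'} (hN : (Nat.card N).Coprime p) (hf : (Nat.card f.ker).Coprime p) :
    (Nat.card (N.comap f)).Coprime p := by
  rw [coprime_card_iff] at hN hf ⊢
  intro x hx hxp
  exact hf x (hN _ hx (by rw [← map_pow, hxp, map_one])) hxp

theorem le_pPrimeCore {p : ℕ} {G : Type*} [Group G] {N : Subgroup G} [h : N.Normal] (hN : (Nat.card N).Coprime p) :
    N ≤ pPrimeCore p G := le_sSup ⟨h, hN⟩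

variable (G p) in
-- A maximal normal `p'`-subgroup `M` absorbs every other one `N`, because `N ⊔ M` is the preimage
-- of the image of `N` in the quotient by `M` and so again has order prime to `p`.
theorem coprime_card_pPrimeCore [hp : Fact p.Prime] : (Nat.card (pPrimeCore p G)).Coprime p := by
  obtain ⟨M, -, ⟨hMn, hMc⟩, hmax⟩ := Set.Finite.exists_le_maximal (a := (⊥ : Subgroup G))
    (s := {N : Subgroup G | N.Normal ∧ (Nat.card N).Coprime p}) (Set.toFinite _)
    ⟨inferInstance, by simp⟩
  suffices h : pPrimeCore p G ≤ M by
    exact Nat.Coprime.coprime_dvd_left (Subgroup.card_dvd_of_le h) hMc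
  refine sSup_le ?_
  rintro N ⟨hNn, hNc⟩
  refine le_sup_left.trans (hmax (y := N ⊔ M) ⟨inferInstance, ?_⟩ le_sup_right)
  have := Subgroup.comap_map_eq (QuotientGroup.mk' M) N
  rw [QuotientGroup.ker_mk'] at this
  rw [← this]
  apply coprime_card_comap
  · exact Nat.Coprime.coprime_dvd_left (Subgroup.card_map_dvd _ _) hNc
  · rwa [QuotientGroup.ker_mk']

theorem eq_bot_of_coprime_quotient_pPrimeCore [hp : Fact p.Prime]
    (N : Subgroup (G ⧸ pPrimeCore p G)) [N.Normal] (hN : (Nat.card N).Coprime p) : N = ⊥ := by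
  have h : N.comap (QuotientGroup.mk' (pPrimeCore p G)) ≤ pPrimeCore p G := by
    apply le_pPrimeCore
    apply coprime_card_comap _ hN
    rw [QuotientGroup.ker_mk']
    exact coprime_card_pPrimeCore G p
  rw [eq_bot_iff]
  intro x hx
  obtain ⟨g, rfl⟩ := QuotientGroup.mk_surjective x
  exact (QuotientGroup.eq_one_iff g).2 (h hx)

theorem disjoint_of_isPGroup_of_coprime [hp : Fact p.Prime] {P N : Subgroup G} (hP : IsPGroup p P)
    (hN : (Nat.card N).Coprime p) : Disjoint P N := by
  obtain ⟨n, hn⟩ := IsPGroup.iff_card.1 hP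
  refine Subgroup.disjoint_of_coprime_natCard ?_
  rw [hn]
  exact (hN.symm).pow_left n

end PPrimeCore

/-! ### Self-centralising normal p-subgroups of solvable groups. -/

theorem isNilpotent_of_commutator_mem_center {A : Type*} [Group A]
    (h : ∀ a b : A, ⁅a, b⁆ ∈ Subgroup.center A) : Group.IsNilpotent A := by
  refine ⟨2, eq_top_iff.2 fun a _ => ?_⟩
  rw [Subgroup.mem_upperCentralSeries_succ_iff]
  intro b
  rw [Subgroup.upperCentralSeries_one]
  exact h a b

/-- In a finite nilpotent normal subgroup of a group without nontrivial normal `p'`-subgroups,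
every element has `p`-power order. -/
theorem isPGroup_of_isNilpotent {H : Type*} [Group H] [Finite H] {p : ℕ} [hp : Fact p.Prime]
    (hO : ∀ M : Subgroup H, M.Normal → (Nat.card M).Coprime p → M = ⊥)
    (A : Subgroup H) [A.Normal] [hA : Group.IsNilpotent A] : IsPGroup p A := by
  apply IsPGroup.of_card (n := (Nat.card A).primeFactorsList.length)
  refine Nat.eq_prime_pow_of_unique_prime_dvd Nat.card_pos.ne' ?_
  intro q hq hqA
  by_contra hqp
  have := Fact.mk hq
  obtain ⟨Q⟩ : Nonempty (Sylow q A) := inferInstance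
  have hQn : (Q : Subgroup A).Normal := by
    have htfae := (Group.isNilpotent_of_finite_tfae (G := A)).out 0 3
    exact htfae.1 hA q this Q
  have hQc := Q.characteristic_of_normal hQn
  have hn : ((Q : Subgroup A).map A.subtype).Normal := inferInstance
  have hbot := hO _ hn (by
    obtain ⟨m, hm⟩ := IsPGroup.iff_card.1 Q.2
    rw [Subgroup.card_map_of_injective A.subtype_injective]
    rw [hm]
    exact ((Nat.coprime_primes hq hp.1).2 hqp).pow_left m)
  rw [Subgroup.map_eq_bot_iff_of_injective _ A.subtype_injective] at hbot
  exact Q.ne_bot_of_dvd_card hqA hbot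

/-- In a finite solvable group without nontrivial normal `p'`-subgroups the largest normal
`p`-subgroup contains its centralizer. -/
theorem centralizer_le_of_isSolvable {H : Type*} [Group H] [Finite H] [Group.IsSolvable H] {p : ℕ}
    [hp : Fact p.Prime] (hO : ∀ M : Subgroup H, M.Normal → (Nat.card M).Coprime p → M = ⊥)
    (N : Subgroup H) [hN : N.Normal]
    (hmax : ∀ M : Subgroup H, M.Normal → IsPGroup p M → M ≤ N) :
    Subgroup.centralizer (N : Set H) ≤ N := by
  classical
  set C := Subgroup.centralizer (N : Set H) with hC
  by_contra hCN
  -- Let `A` be the last derived term of `C` not inside `N`. Its commutators lie in `N`, which `A`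
  -- centralises, so `A` is nilpotent; it is then a normal `p`-subgroup and lies in `N` after all.
  have hex : ∃ k, (derivedSeries C k).map C.subtype ≤ N := by
    obtain ⟨n, hn⟩ := Group.IsSolvable.solvable (G := C)
    exact ⟨n, by rw [hn, Subgroup.map_bot]; exact bot_le⟩
  have h0 : Nat.find hex ≠ 0 := fun h => hCN (by
    have h1 := Nat.find_spec hex
    rwa [h, derivedSeries_zero, ← MonoidHom.range_eq_map, Subgroup.range_subtype] at h1)
  obtain ⟨k, hk⟩ := Nat.exists_eq_succ_of_ne_zero h0
  have hk1 : ¬ (derivedSeries C k).map C.subtype ≤ N := Nat.find_min hex (by omega)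
  have hk2 : (derivedSeries C (k + 1)).map C.subtype ≤ N := by simpa [hk] using Nat.find_spec hex
  set A := (derivedSeries C k).map C.subtype with hA
  have hAn : A.Normal := inferInstance
  have hAC : A ≤ C := Subgroup.map_subtype_le _
  have hnil : Group.IsNilpotent A := by
    apply isNilpotent_of_commutator_mem_center
    rintro ⟨a, ha⟩ ⟨b, hb⟩
    rw [Subgroup.mem_center_iff]
    rintro ⟨c, hc⟩
    apply Subtype.ext
    have hab : ⁅a, b⁆ ∈ N := by
      obtain ⟨a, ha, rfl⟩ := ha
      obtain ⟨b, hb, rfl⟩ := hb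
      rw [← map_commutatorElement]
      apply hk2
      apply Subgroup.mem_map_of_mem
      rw [derivedSeries_succ]
      exact Subgroup.commutator_mem_commutator ha hb
    exact ((Subgroup.mem_centralizer_iff.1 (hAC hc)) _ hab).symm
  exact hk1 (hmax A hAn (isPGroup_of_isNilpotent hO A))

/-! ### Odd-order elements acting on normal 2-subgroups; isoclinism from subdirect products. -/

theorem eq_one_of_pow_odd_of_pow_two_pow {H : Type*} [Group H] {b : H} {m k : ℕ} (hm : Odd m)
    (hbm : b ^ m = 1) (hk : b ^ 2 ^ k = 1) : b = 1 := by
  have hd := Nat.dvd_gcd (orderOf_dvd_of_pow_eq_one hbm) (orderOf_dvd_of_pow_eq_one hk)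
  rwa [(Nat.Coprime.pow_right k hm.coprime_two_right : m.gcd (2 ^ k) = 1), Nat.dvd_one,
    orderOf_eq_one_iff] at hd

/-- If `t` has odd order and moves `x` by a `2`-element `b` that commutes with `t`, then `t` fixes
`x`. -/
theorem conj_eq_self_of_odd {H : Type*} [Group H] {t x b : H} {m : ℕ} (hm : Odd m)
    (htm : t ^ m = 1) (hb : t * b = b * t) (hx : t * x * t⁻¹ = x * b) (hb2 : ∃ k, b ^ 2 ^ k = 1) :
    b = 1 := by
  have h : ∀ j : ℕ, t ^ j * x * (t ^ j)⁻¹ = x * b ^ j := by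
    intro j
    induction j with
    | zero => simp
    | succ j ih =>
      have h1 : t ^ (j + 1) * x * (t ^ (j + 1))⁻¹ = t * (t ^ j * x * (t ^ j)⁻¹) * t⁻¹ := by
        rw [pow_succ']; group
      have h2 : t * b ^ j * t⁻¹ = b ^ j := by
        rw [((show Commute t b from hb).pow_right j).eq, mul_inv_cancel_right]
      calc _ = (t * x * t⁻¹) * (t * b ^ j * t⁻¹) := by rw [h1, ih]; group
        _ = _ := by rw [hx, h2, mul_assoc, ← pow_succ']
  have hbm : b ^ m = 1 := by
    have := h m
    rw [htm] at this
    simpa using this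
  obtain ⟨k, hk⟩ := hb2
  exact eq_one_of_pow_odd_of_pow_two_pow hm hbm hk

/-- Elements of odd order centralise the cyclic normal `2`-subgroups. -/
theorem commute_of_odd_of_isCyclic {H : Type*} [Group H] [Finite H] {a t : H} {n m : ℕ}
    (hm : Odd m) (htm : t ^ m = 1) (ha : orderOf a = 2 ^ n) (hta : t * a * t⁻¹ ∈ Subgroup.zpowers a) :
    t * a = a * t := by
  obtain ⟨s, hs⟩ := hta
  change a ^ s = t * a * t⁻¹ at hs
  have hcomm : ∀ j : ℕ, t ^ j * a * (t ^ j)⁻¹ = a ^ s ^ j := by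
    intro j
    induction j with
    | zero => simp
    | succ j ih =>
      calc t ^ (j + 1) * a * (t ^ (j + 1))⁻¹ = t * (t ^ j * a * (t ^ j)⁻¹) * t⁻¹ := by
            rw [pow_succ']; group
        _ = (t * a * t⁻¹) ^ (s ^ j) := by rw [ih, conj_zpow]
        _ = _ := by rw [← hs, ← zpow_mul, pow_succ']
  have h1 := hcomm m
  rw [htm, one_mul, inv_one, mul_one] at h1
  have h2 : (2 : ℤ) ^ n ∣ s ^ m - 1 := by
    conv_lhs at h1 => rw [← zpow_one a]
    rw [zpow_eq_zpow_iff_modEq, ha, Int.modEq_iff_dvd] at h1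
    exact_mod_cast h1
  have h3 : (2 : ℤ) ^ n ∣ s - 1 := by
    rcases Nat.eq_zero_or_pos n with rfl | hn
    · simp
    have hso : Odd s := by
      have h4 : (2 : ℤ) ∣ s ^ m - 1 := (dvd_pow_self 2 hn.ne').trans h2
      by_contra hev
      rw [Int.not_odd_iff_even] at hev
      have h5 : Even (s ^ m) := hev.pow_of_ne_zero hm.pos.ne'
      obtain ⟨u, hu⟩ := h4
      obtain ⟨v, hv⟩ := h5
      omega
    -- The other factor of `s ^ m - 1` is a sum of `m` odd terms with `m` odd, so it is prime to 2.
    rw [← mul_geom_sum, mul_comm] at h2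
    refine IsCoprime.dvd_of_dvd_mul_left ?_ h2
    apply IsCoprime.pow_left
    rw [Int.isCoprime_two_left]
    have hsum : ∀ j : ℕ, Even (∑ i ∈ Finset.range j, s ^ i - j) := by
      intro j
      induction j with
      | zero => simp
      | succ j ih =>
        rw [Finset.sum_range_succ, Nat.cast_succ, add_sub_add_comm]
        exact ih.add ((hso.pow).sub_odd odd_one)
    have := (hsum m).add_odd ((Int.odd_coe_nat m).2 hm)
    rwa [sub_add_cancel] at this
  have h4 : t * a * t⁻¹ = a := by
    rw [← hs]
    conv_rhs => rw [← zpow_one a]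
    rw [zpow_eq_zpow_iff_modEq, ha, Int.modEq_iff_dvd]
    rw [← dvd_neg] at h3
    rw [neg_sub] at h3
    exact_mod_cast h3
  rwa [mul_inv_eq_iff_eq_mul] at h4

/-- Elements of odd order centralise the normal generalised quaternion subgroups of order at least
sixteen. -/
theorem commute_of_odd_of_quaternion {H : Type*} [Group H] [Finite H] (N : Subgroup H)
    [hN : N.Normal] {n : ℕ} (hn : 2 ≤ n) (e : N ≃* QuaternionGroup (2 ^ n)) {t : H} {m : ℕ}
    (hm : Odd m) (htm : t ^ m = 1) : t ∈ Subgroup.centralizer (N : Set H) := by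
  set a : H := ((e.symm (.a 1) : N) : H) with ha
  set x : H := ((e.symm (.xa 0) : N) : H) with hx
  have hoa : orderOf a = 2 ^ (n + 1) := by
    rw [ha, Subgroup.orderOf_coe, MulEquiv.orderOf_eq, QuaternionGroup.orderOf_a_one, pow_succ']
  have hN2 : ∀ y : N, (y : H) ∈ Subgroup.zpowers a ∨ (y : H) * x ∈ Subgroup.zpowers a ∧
      (y : H) ^ 4 = 1 ∧ x⁻¹ * y ∈ Subgroup.zpowers a := by
    intro y
    obtain ⟨q, rfl⟩ := e.symm.surjective y
    have hza : ∀ i : ZMod (2 * 2 ^ n), ((e.symm (.a i) : N) : H) ∈ Subgroup.zpowers a := by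
      intro i
      obtain ⟨i, rfl⟩ := ZMod.natCast_zmod_surjective i
      rw [← QuaternionGroup.a_one_pow, map_pow, Subgroup.coe_pow]
      exact Subgroup.npow_mem_zpowers _ _
    rcases q with i | i
    · exact Or.inl (hza i)
    · right
      refine ⟨?_, ?_, ?_⟩
      · rw [hx, ← Subgroup.coe_mul, ← map_mul, QuaternionGroup.xa_mul_xa]
        exact hza _
      · rw [← Subgroup.coe_pow, ← map_pow, QuaternionGroup.xa_pow_four, map_one, Subgroup.coe_one]
      · have : (QuaternionGroup.xa i : QuaternionGroup (2 ^ n)) = .xa 0 * .a i := by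
          rw [QuaternionGroup.xa_mul_a, zero_add]
        rw [this, map_mul, Subgroup.coe_mul, inv_mul_cancel_left]
        exact hza i
  have hxx : x ∉ Subgroup.zpowers a := by
    rintro ⟨i, hi⟩
    change a ^ i = x at hi
    rw [ha, hx, ← Subgroup.coe_zpow, ← map_zpow, Subtype.coe_inj, e.symm.injective.eq_iff] at hi
    have h1 : ∀ i : ℤ, ∃ j, (QuaternionGroup.a 1 : QuaternionGroup (2 ^ n)) ^ i = .a j := by
      intro i
      rcases Int.eq_nat_or_neg i with ⟨k, rfl | rfl⟩
      · exact ⟨k, by rw [zpow_natCast, QuaternionGroup.a_one_pow]⟩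
      · exact ⟨-k, by rw [zpow_neg, zpow_natCast, QuaternionGroup.a_one_pow]; rfl⟩
    obtain ⟨j, hj⟩ := h1 i
    rw [hj] at hi
    cases hi
  have hconj : ∀ y : N, t * y * t⁻¹ ∈ N := fun y => hN.conj_mem y y.2 t
  -- Here `2 ≤ n` matters: `a` has order at least 8, while elements of `N` outside `⟨a⟩` have order
  -- dividing 4, so `t` preserves `⟨a⟩`. In `Q₈` this fails.
  have hta : t * a = a * t := by
    apply commute_of_odd_of_isCyclic hm htm hoa
    rcases hN2 ⟨_, hconj (e.symm (.a 1))⟩ with h | ⟨-, h, -⟩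
    · exact h
    · exfalso
      change (t * a * t⁻¹) ^ 4 = 1 at h
      rw [conj_pow, mul_inv_eq_one, mul_eq_left] at h
      have h1 := Nat.le_of_dvd (by norm_num) (hoa ▸ orderOf_dvd_of_pow_eq_one h)
      have := Nat.pow_le_pow_right (n := 2) (by norm_num) (show 3 ≤ n + 1 by omega)
      omega
  have htx : t * x = x * t := by
    have hmem : x⁻¹ * (t * x * t⁻¹) ∈ Subgroup.zpowers a := by
      rcases hN2 ⟨_, hconj (e.symm (.xa 0))⟩ with h | ⟨-, -, h⟩
      · exfalso
        obtain ⟨i, hi⟩ := h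
        change a ^ i = t * x * t⁻¹ at hi
        apply hxx
        refine ⟨i, ?_⟩
        change a ^ i = x
        have h1 : a ^ i = t⁻¹ * a ^ i * t := by
          have := ((show Commute t a from hta).zpow_right i).eq
          rw [mul_assoc, ← this, inv_mul_cancel_left]
        rw [h1, hi]
        group
      · exact h
    obtain ⟨i, hi⟩ := hmem
    change a ^ i = _ at hi
    have h1 : a ^ i = 1 := by
      refine conj_eq_self_of_odd hm htm (x := x) ((show Commute t a from hta).zpow_right i).eq ?_
        ⟨n + 1, ?_⟩
      · rw [hi]; group
      · rw [← hoa, ← zpow_natCast, ← zpow_mul, mul_comm, zpow_mul, zpow_natCast,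
          pow_orderOf_eq_one, one_zpow]
    rw [h1, eq_comm, inv_mul_eq_one] at hi
    conv_rhs => rw [hi]
    group
  rw [Subgroup.mem_centralizer_iff]
  intro y hy
  rcases hN2 ⟨y, hy⟩ with ⟨i, hi⟩ | ⟨-, -, ⟨i, hi⟩⟩
  · change a ^ i = y at hi
    rw [← hi]
    exact ((show Commute t a from hta).zpow_right i).eq.symm
  · change a ^ i = x⁻¹ * y at hi
    have : y = x * a ^ i := by rw [hi, mul_inv_cancel_left]
    rw [this]
    exact ((show Commute t x from htx).mul_right
      ((show Commute t a from hta).zpow_right i)).eq.symm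

/-- A surjection that is injective on the commutator subgroup identifies the commutator subgroups. -/
theorem exists_commutator_mulEquiv {Γ M : Type*} [Group Γ] [Group M] (f : Γ →* M)
    (hf : Function.Surjective f) (hinj : ∀ γ ∈ commutator Γ, f γ = 1 → γ = 1) :
    ∃ ψ : commutator Γ ≃* commutator M, ∀ γ, (ψ γ : M) = f γ := by
  have hmap : (commutator Γ).map f = commutator M := by
    rw [commutator_def, Subgroup.map_commutator, ← MonoidHom.range_eq_map,
      MonoidHom.range_eq_top.2 hf, commutator_def]
  refine ⟨(MulEquiv.ofBijective (f.subgroupMap (commutator Γ))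
    ⟨?_, f.subgroupMap_surjective _⟩).trans (MulEquiv.subgroupCongr hmap), fun γ => rfl⟩
  rw [injective_iff_map_eq_one]
  intro γ hγ
  exact Subtype.ext (hinj γ γ.2 (congrArg Subtype.val hγ))

/-- A subdirect product of `H` and `L` whose commutator subgroup embeds into both factors is the
graph of an isoclinism. -/
theorem isIsoclinic_of_subgroup {H L : Type*} [Group H] [Group L] (Γ : Subgroup (H × L))
    (h1 : ∀ h, ∃ g, (h, g) ∈ Γ) (h2 : ∀ g, ∃ h, (h, g) ∈ Γ)
    (hc : ∀ γ ∈ commutator Γ, γ.1.1 = 1 ↔ γ.1.2 = 1) : IsIsoclinic H L := by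
  let f₁ : Γ →* H := (MonoidHom.fst H L).comp Γ.subtype
  let f₂ : Γ →* L := (MonoidHom.snd H L).comp Γ.subtype
  have hf₁ : Function.Surjective f₁ := fun h => let ⟨g, hg⟩ := h1 h; ⟨⟨(h, g), hg⟩, rfl⟩
  have hf₂ : Function.Surjective f₂ := fun g => let ⟨h, hg⟩ := h2 g; ⟨⟨(h, g), hg⟩, rfl⟩
  have hcc : ∀ γ δ : Γ, ⁅f₁ γ, f₁ δ⁆ = 1 ↔ ⁅f₂ γ, f₂ δ⁆ = 1 := fun γ δ =>
    hc ⁅γ, δ⁆ (Subgroup.commutator_mem_commutator (Subgroup.mem_top _) (Subgroup.mem_top _))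
  -- An element is central when its commutators vanish, and these vanish in both coordinates
  -- simultaneously. Hence both maps from `Γ` to the central quotients have the same kernel.
  have hz : ∀ γ : Γ, f₁ γ ∈ Subgroup.center H ↔ f₂ γ ∈ Subgroup.center L := by
    intro γ
    simp only [Subgroup.mem_center_iff]
    constructor
    · intro h g
      obtain ⟨δ, rfl⟩ := hf₂ g
      rw [← commutatorElement_eq_one_iff_mul_comm, ← hcc, commutatorElement_eq_one_iff_mul_comm, h]
    · intro h g
      obtain ⟨δ, rfl⟩ := hf₁ g
      rw [← commutatorElement_eq_one_iff_mul_comm, hcc, commutatorElement_eq_one_iff_mul_comm, h]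
  let q₁ := (QuotientGroup.mk' (Subgroup.center H)).comp f₁
  let q₂ := (QuotientGroup.mk' (Subgroup.center L)).comp f₂
  have hq₁ : Function.Surjective q₁ := (QuotientGroup.mk'_surjective _).comp hf₁
  have hq₂ : Function.Surjective q₂ := (QuotientGroup.mk'_surjective _).comp hf₂
  have hker : q₁.ker = q₂.ker := by
    ext γ
    rw [MonoidHom.mem_ker, MonoidHom.mem_ker]
    change (QuotientGroup.mk (f₁ γ) : H ⧸ _) = 1 ↔ (QuotientGroup.mk (f₂ γ) : L ⧸ _) = 1
    rw [QuotientGroup.eq_one_iff, QuotientGroup.eq_one_iff, hz]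
  let φ : H ⧸ Subgroup.center H ≃* L ⧸ Subgroup.center L :=
    (QuotientGroup.quotientKerEquivOfSurjective q₁ hq₁).symm.trans
      ((QuotientGroup.quotientMulEquivOfEq hker).trans
        (QuotientGroup.quotientKerEquivOfSurjective q₂ hq₂))
  have hφ : ∀ γ : Γ, φ (QuotientGroup.mk (f₁ γ)) = QuotientGroup.mk (f₂ γ) := by
    intro γ
    have : (QuotientGroup.quotientKerEquivOfSurjective q₁ hq₁).symm (QuotientGroup.mk (f₁ γ)) =
        QuotientGroup.mk γ := by
      rw [MulEquiv.symm_apply_eq]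
      rfl
    change (QuotientGroup.quotientKerEquivOfSurjective q₂ hq₂)
      ((QuotientGroup.quotientMulEquivOfEq hker)
        ((QuotientGroup.quotientKerEquivOfSurjective q₁ hq₁).symm (QuotientGroup.mk (f₁ γ)))) = _
    rw [this]
    rfl
  obtain ⟨ψ₁, hψ₁⟩ := exists_commutator_mulEquiv f₁ hf₁ fun γ hγ h => Subtype.ext (Prod.ext h ((hc γ hγ).1 h))
  obtain ⟨ψ₂, hψ₂⟩ := exists_commutator_mulEquiv f₂ hf₂ fun γ hγ h => Subtype.ext (Prod.ext ((hc γ hγ).2 h) h)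
  refine ⟨φ, ψ₁.symm.trans ψ₂, ?_⟩
  intro g₁ g₂ k₁ k₂ e₁ e₂
  obtain ⟨γ₁, rfl⟩ := hf₁ g₁
  obtain ⟨γ₂, rfl⟩ := hf₁ g₂
  rw [hφ, QuotientGroup.eq] at e₁ e₂
  have hψ : ψ₁.symm ⟨⁅f₁ γ₁, f₁ γ₂⁆, Subgroup.commutator_mem_commutator (Subgroup.mem_top _)
      (Subgroup.mem_top _)⟩ = ⟨⁅γ₁, γ₂⁆, Subgroup.commutator_mem_commutator (Subgroup.mem_top _)
      (Subgroup.mem_top _)⟩ := by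
    rw [MulEquiv.symm_apply_eq]
    apply Subtype.ext
    rw [hψ₁, map_commutatorElement]
  rw [MulEquiv.trans_apply, hψ, hψ₂, map_commutatorElement]
  obtain ⟨c₁, hc₁, rfl⟩ : ∃ c ∈ Subgroup.center L, k₁ = f₂ γ₁ * c := ⟨_, e₁, by group⟩
  obtain ⟨c₂, hc₂, rfl⟩ : ∃ c ∈ Subgroup.center L, k₂ = f₂ γ₂ * c := ⟨_, e₂, by group⟩
  have hcomm : ∀ c ∈ Subgroup.center L, ∀ a b : L, ⁅a * c, b⁆ = ⁅a, b⁆ := by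
    intro c hc a b
    rw [commutatorElement_def, commutatorElement_def, mul_assoc a c b,
      ← Subgroup.mem_center_iff.1 hc b]
    group
  rw [hcomm c₁ hc₁, ← commutatorElement_inv (f₂ γ₂ * c₂), hcomm c₂ hc₂, commutatorElement_inv]

/-! ### Pairs inducing the same automorphism of a normal subgroup. -/

section ConjGraph

variable {H L : Type*} [Group H] [Group L] {N : Subgroup H} [N.Normal]

/-- The pairs `(h, g)` that induce the same automorphism of `N`, with `N` embedded in `L`. -/
def conjGraph (β : N →* L) : Subgroup (H × L) where
  carrier := {γ | ∀ n : N, γ.2 * β n * γ.2⁻¹ = β (MulAut.conjNormal γ.1 n)}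
  one_mem' := by intro n; simp
  mul_mem' := by
    intro γ δ hγ hδ n
    simp only [Set.mem_ofPred_eq] at hγ hδ
    rw [Prod.fst_mul, Prod.snd_mul, map_mul, MulAut.mul_apply, ← hγ, ← hδ]
    group
  inv_mem' := by
    intro γ hγ n
    simp only [Set.mem_ofPred_eq] at hγ
    have := hγ (MulAut.conjNormal γ.1⁻¹ n)
    rw [← MulAut.mul_apply, ← map_mul, mul_inv_cancel, map_one, MulAut.one_apply] at this
    rw [Prod.fst_inv, Prod.snd_inv, ← this]
    group

/-- The embedding of `N` in `conjGraph β`. -/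
def conjGraphDiag (β : N →* L) : N →* conjGraph β :=
  (N.subtype.prod β).codRestrict _ fun m n => by
    change β m * β n * (β m)⁻¹ = _
    rw [← map_inv, ← map_mul, ← map_mul]
    congr 1

theorem conjGraphDiag_range_normal (β : N →* L) : (conjGraphDiag β).range.Normal := by
  refine ⟨?_⟩
  rintro _ ⟨n, rfl⟩ ⟨⟨h, g⟩, hγ⟩
  refine ⟨MulAut.conjNormal h n, ?_⟩
  apply Subtype.ext
  refine Prod.ext ?_ ?_
  · exact MulAut.conjNormal_apply h n
  · exact (hγ n).symm

end ConjGraph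

/-! ### `Q₈` inside the matrices over the field with three elements. -/

section Matrices

open Matrix

/-- The quaternion group of order eight in the ring of `2 × 2` matrices over `𝔽₃`. -/
def quaternionMatrix : QuaternionGroup 2 →* Matrix (Fin 2) (Fin 2) (ZMod 3) where
  toFun q := match q with
    | .a i => !![0, -1; 1, 0] ^ i.val
    | .xa i => !![1, 1; 1, -1] * !![0, -1; 1, 0] ^ i.val
  map_one' := by decide +kernel
  map_mul' := by decide +kernel

theorem quaternionMatrix_eq_one : ∀ q, quaternionMatrix q = 1 → q = 1 := by decide +kernel

theorem det_quaternionMatrix : ∀ q, (quaternionMatrix q).det = 1 := by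
  simp only [Matrix.det_fin_two]
  decide +kernel

/-- Automorphisms of `Q₈` send the standard generators to non-commuting pairs, so this makes every
automorphism of `Q₈` a conjugation in `GL₂(3)`. -/
theorem exists_conj_quaternionMatrix : ∀ p q : QuaternionGroup 2, p * q ≠ q * p →
    ∃ a b c d : ZMod 3, a * d - b * c ≠ 0 ∧
      !![a, b; c, d] * quaternionMatrix (.a 1) = quaternionMatrix p * !![a, b; c, d] ∧
      !![a, b; c, d] * quaternionMatrix (.xa 0) = quaternionMatrix q * !![a, b; c, d] := by
  decide +kernel

/-- The representation is absolutely irreducible, so only scalars commute with it. -/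
theorem centralizer_quaternionMatrix : ∀ a b c d : ZMod 3, a * d - b * c ≠ 0 →
      !![a, b; c, d] * quaternionMatrix (.a 1) = quaternionMatrix (.a 1) * !![a, b; c, d] →
      !![a, b; c, d] * quaternionMatrix (.xa 0) = quaternionMatrix (.xa 0) * !![a, b; c, d] →
      !![a, b; c, d] = 1 ∨ !![a, b; c, d] = -1 := by
  decide +kernel

theorem card_SL_two_three : Nat.card (Matrix.SpecialLinearGroup (Fin 2) (ZMod 3)) = 24 := by
  have e : Matrix.SpecialLinearGroup (Fin 2) (ZMod 3) ≃
      {v : ZMod 3 × ZMod 3 × ZMod 3 × ZMod 3 // v.1 * v.2.2.2 - v.2.1 * v.2.2.1 = 1} :=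
    { toFun := fun A => ⟨(A.1 0 0, A.1 0 1, A.1 1 0, A.1 1 1), by
        rw [← Matrix.det_fin_two]; exact A.2⟩
      invFun := fun v => ⟨!![v.1.1, v.1.2.1; v.1.2.2.1, v.1.2.2.2], by
        rw [Matrix.det_fin_two]; exact v.2⟩
      left_inv := fun A => Subtype.ext (Matrix.eta_fin_two A.1).symm
      right_inv := fun v => rfl }
  rw [Nat.card_congr e, Nat.card_eq_fintype_card]
  decide +kernel

theorem card_GL_two_three : Nat.card (GL (Fin 2) (ZMod 3)) = 48 := by
  rw [Matrix.card_GL_field]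
  simp [Fin.prod_univ_two, ZMod.card]

end Matrices

/-! ### Groups with a self-centralising normal `Q₈`. -/

section QuaternionRepresentation

open Matrix

theorem QuaternionGroup.monoidHom_ext {n : ℕ} [NeZero n] {M : Type*} [Group M]
    {f g : QuaternionGroup n →* M} (ha : f (.a 1) = g (.a 1)) (hx : f (.xa 0) = g (.xa 0)) :
    f = g := by
  have h : ∀ i, f (.a i) = g (.a i) := by
    intro i
    obtain ⟨i, rfl⟩ := ZMod.natCast_zmod_surjective i
    rw [← QuaternionGroup.a_one_pow, map_pow, map_pow, ha]
  ext q
  rcases q with i | i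
  · exact h i
  · have : (QuaternionGroup.xa i : QuaternionGroup n) = .xa 0 * .a i := by
      rw [QuaternionGroup.xa_mul_a, zero_add]
    rw [this, map_mul, map_mul, hx, h]

theorem centralizer_quaternionMatrix_GL {g : GL (Fin 2) (ZMod 3)}
    (h : ∀ q, (g : Matrix (Fin 2) (Fin 2) (ZMod 3)) * quaternionMatrix q =
      quaternionMatrix q * g) : g = 1 ∨ g = -1 := by
  have hdet : (g : Matrix (Fin 2) (Fin 2) (ZMod 3)).det ≠ 0 := g.det_ne_zero
  have h1 := h (.a 1)
  have h2 := h (.xa 0)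
  rw [det_fin_two] at hdet
  rw [eta_fin_two (g : Matrix (Fin 2) (Fin 2) (ZMod 3))] at h1 h2
  rcases centralizer_quaternionMatrix _ _ _ _ hdet h1 h2 with h3 | h3
  · left
    apply Units.ext
    rw [eta_fin_two (g : Matrix (Fin 2) (Fin 2) (ZMod 3)), h3, Units.val_one]
  · right
    apply Units.ext
    rw [eta_fin_two (g : Matrix (Fin 2) (Fin 2) (ZMod 3)), h3, Units.val_neg, Units.val_one]

section Eight

variable {H : Type*} [Group H] {N : Subgroup H}

/-- The representation over `𝔽₃` of a quaternion group of order eight. -/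
def quaternionRep (e : N ≃* QuaternionGroup 2) : N →* GL (Fin 2) (ZMod 3) :=
  quaternionMatrix.toHomUnits.comp e.toMonoidHom

theorem coe_quaternionRep (e : N ≃* QuaternionGroup 2) (n : N) :
    (quaternionRep e n : Matrix (Fin 2) (Fin 2) (ZMod 3)) = quaternionMatrix (e n) := rfl

theorem quaternionRep_injective (e : N ≃* QuaternionGroup 2) :
    Function.Injective (quaternionRep e) := by
  rw [injective_iff_map_eq_one]
  intro n hn
  have := quaternionMatrix_eq_one (e n) (by rw [← coe_quaternionRep, hn]; rfl)
  simpa using this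

variable [hN : N.Normal]

theorem mem_conjGraph_quaternionRep (e : N ≃* QuaternionGroup 2) {h : H} {g : GL (Fin 2) (ZMod 3)}
    (ha : (g : Matrix (Fin 2) (Fin 2) (ZMod 3)) * quaternionMatrix (.a 1) =
      quaternionMatrix (e (MulAut.conjNormal h (e.symm (.a 1)))) * g)
    (hx : (g : Matrix (Fin 2) (Fin 2) (ZMod 3)) * quaternionMatrix (.xa 0) =
      quaternionMatrix (e (MulAut.conjNormal h (e.symm (.xa 0)))) * g) :
    (h, g) ∈ conjGraph (quaternionRep e) := by
  have key : ((MulAut.conj g).toMonoidHom.comp (quaternionRep e)).comp e.symm.toMonoidHom =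
      ((quaternionRep e).comp (MulAut.conjNormal h).toMonoidHom).comp e.symm.toMonoidHom := by
    apply QuaternionGroup.monoidHom_ext
    · change g * quaternionRep e (e.symm _) * g⁻¹ = quaternionRep e _
      rw [mul_inv_eq_iff_eq_mul]
      apply Units.ext
      rw [Units.val_mul, Units.val_mul, coe_quaternionRep, coe_quaternionRep,
        MulEquiv.apply_symm_apply]
      exact ha
    · change g * quaternionRep e (e.symm _) * g⁻¹ = quaternionRep e _
      rw [mul_inv_eq_iff_eq_mul]
      apply Units.ext
      rw [Units.val_mul, Units.val_mul, coe_quaternionRep, coe_quaternionRep,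
        MulEquiv.apply_symm_apply]
      exact hx
  intro n
  have := DFunLike.congr_fun key (e n)
  simpa using this

theorem exists_mem_conjGraph_quaternionRep (e : N ≃* QuaternionGroup 2) (h : H) :
    ∃ g, (h, g) ∈ conjGraph (quaternionRep e) := by
  obtain ⟨a, b, c, d, hdet, h1, h2⟩ := exists_conj_quaternionMatrix
    (e (MulAut.conjNormal h (e.symm (.a 1)))) (e (MulAut.conjNormal h (e.symm (.xa 0)))) (by
      rw [← map_mul, ← map_mul, ← map_mul, ← map_mul, ← map_mul, ← map_mul]
      simp only [ne_eq, EmbeddingLike.apply_eq_iff_eq]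
      decide)
  exact ⟨GeneralLinearGroup.mkOfDetNeZero !![a, b; c, d] (by rwa [det_fin_two_of]),
    mem_conjGraph_quaternionRep e h1 h2⟩

theorem eq_one_or_eq_neg_one_of_mem_conjGraph (e : N ≃* QuaternionGroup 2)
    {g : GL (Fin 2) (ZMod 3)} (hg : (1, g) ∈ conjGraph (quaternionRep e)) : g = 1 ∨ g = -1 := by
  have h : ∀ q, (g : Matrix (Fin 2) (Fin 2) (ZMod 3)) * quaternionMatrix q = quaternionMatrix q * g := by
    intro q
    have := hg (e.symm q)
    simp only [map_one, MulAut.one_apply] at this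
    rw [mul_inv_eq_iff_eq_mul] at this
    have := congrArg Units.val this
    rwa [Units.val_mul, Units.val_mul, coe_quaternionRep, MulEquiv.apply_symm_apply] at this
  exact centralizer_quaternionMatrix_GL h

theorem neg_one_mem_conjGraph (e : N ≃* QuaternionGroup 2) :
    (1, -1) ∈ conjGraph (quaternionRep e) := by
  intro n
  simp

theorem neg_one_ne_one_GL : (-1 : GL (Fin 2) (ZMod 3)) ≠ 1 := by
  intro h
  have h1 := congrArg (fun g : GL (Fin 2) (ZMod 3) => (g : Matrix (Fin 2) (Fin 2) (ZMod 3)) 0 0) h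
  revert h1
  simp only [Units.val_neg, Units.val_one, Matrix.neg_apply, Matrix.one_apply_eq]
  decide

/-- The elements of `conjGraph` with trivial second component. -/
theorem mem_of_mem_conjGraph_one (e : N ≃* QuaternionGroup 2)
    (hC : Subgroup.centralizer (N : Set H) ≤ N) {h : H}
    (hh : (h, 1) ∈ conjGraph (quaternionRep e)) :
    ∃ hhN : h ∈ N, (⟨h, hhN⟩ : N) ∈ Subgroup.center N := by
  have hc : h ∈ Subgroup.centralizer (N : Set H) := by
    rw [Subgroup.mem_centralizer_iff]
    intro n hn
    have := hh ⟨n, hn⟩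
    simp only [one_mul, inv_one, mul_one] at this
    have := congrArg Subtype.val (quaternionRep_injective e this)
    rw [MulAut.conjNormal_apply, eq_mul_inv_iff_mul_eq] at this
    exact this
  refine ⟨hC hc, ?_⟩
  rw [Subgroup.mem_center_iff]
  rintro ⟨n, hn⟩
  exact Subtype.ext (Subgroup.mem_centralizer_iff.1 hc n hn)

/-- The projection to `H` is onto, since `GL₂(3)` induces all automorphisms of `Q₈`; its kernel
consists of the pairs `(1, ±1)`. -/
theorem card_conjGraph (e : N ≃* QuaternionGroup 2) :
    Nat.card (conjGraph (quaternionRep e)) = 2 * Nat.card H := by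
  let f : conjGraph (quaternionRep e) →* H := (MonoidHom.fst _ _).comp (Subgroup.subtype _)
  have hf : Function.Surjective f := fun h =>
    let ⟨g, hg⟩ := exists_mem_conjGraph_quaternionRep e h; ⟨⟨(h, g), hg⟩, rfl⟩
  let w : conjGraph (quaternionRep e) := ⟨(1, -1), neg_one_mem_conjGraph e⟩
  have hw : orderOf w = 2 := by
    refine orderOf_eq_prime ?_ fun h => neg_one_ne_one_GL (congrArg (fun γ => γ.1.2) h)
    apply Subtype.ext
    simp [w]
  have hker : f.ker = Subgroup.zpowers w := by
    apply le_antisymm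
    · rintro ⟨⟨h, g⟩, hγ⟩ hh
      obtain rfl : h = 1 := hh
      rcases eq_one_or_eq_neg_one_of_mem_conjGraph e hγ with rfl | rfl
      · exact Subgroup.one_mem _
      · exact Subgroup.mem_zpowers w
    · rw [Subgroup.zpowers_le]
      rfl
  rw [Subgroup.card_eq_card_quotient_mul_card_subgroup f.ker, hker, Nat.card_zpowers, hw, mul_comm,
    ← hker, Nat.card_congr (QuotientGroup.quotientKerEquivOfSurjective f hf).toEquiv]

/-- The projection to `GL₂(3)` has kernel `Z(N)`, of order 2, because `N` contains its centralizer.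
Thus `H` has the order of a subgroup of `GL₂(3)`, without having to embed in it. -/
theorem card_range_conjGraph (e : N ≃* QuaternionGroup 2)
    (hC : Subgroup.centralizer (N : Set H) ≤ N) :
    Nat.card ((MonoidHom.snd _ _).comp (conjGraph (quaternionRep e)).subtype).range =
      Nat.card H := by
  set f := (MonoidHom.snd _ _).comp (conjGraph (quaternionRep e)).subtype with hf
  obtain ⟨z, hz1, hz2, hzc, -, hzz⟩ :=
    IsGeneralizedQuaternion.exists_involution (H := N) ⟨1, le_rfl, ⟨e⟩⟩
  have hzΓ : ((z : H), 1) ∈ conjGraph (quaternionRep e) := by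
    intro n
    have : MulAut.conjNormal (z : H) n = n := by
      apply Subtype.ext
      have := congrArg Subtype.val (Subgroup.mem_center_iff.1 hzc n)
      rw [MulAut.conjNormal_apply, mul_inv_eq_iff_eq_mul]
      exact this.symm
    simp [this]
  let w : conjGraph (quaternionRep e) := ⟨(z, 1), hzΓ⟩
  have hw : orderOf w = 2 := by
    refine orderOf_eq_prime ?_ fun h => hz1 (Subtype.ext (congrArg (fun γ => γ.1.1) h))
    apply Subtype.ext
    have : (z : H) ^ 2 = 1 := congrArg Subtype.val hz2
    simp [w, this]
  have hker : f.ker = Subgroup.zpowers w := by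
    apply le_antisymm
    · rintro ⟨⟨h, g⟩, hγ⟩ hh
      obtain rfl : g = 1 := hh
      obtain ⟨hhN, hhc⟩ := mem_of_mem_conjGraph_one e hC hγ
      rcases hzz _ hhc with h1 | h1
      · obtain rfl : h = 1 := congrArg Subtype.val h1
        exact Subgroup.one_mem _
      · obtain rfl : h = z := congrArg Subtype.val h1
        exact Subgroup.mem_zpowers w
    · rw [Subgroup.zpowers_le]
      rfl
  have h1 := Subgroup.card_eq_card_quotient_mul_card_subgroup f.ker
  rw [hker, Nat.card_zpowers, hw, ← hker,
    Nat.card_congr (QuotientGroup.quotientKerEquivRange f).toEquiv, card_conjGraph] at h1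
  omega

theorem card_dvd_of_centralizer_le (e : N ≃* QuaternionGroup 2)
    (hC : Subgroup.centralizer (N : Set H) ≤ N) : Nat.card H ∣ 48 := by
  rw [← card_range_conjGraph e hC, ← card_GL_two_three]
  exact Subgroup.card_subgroup_dvd_card _

variable [Finite H]

/-- In `conjGraph` there is a subgroup `SL₂(3)` projecting injectively to both factors. -/
theorem exists_subgroup_conjGraph (e : N ≃* QuaternionGroup 2)
    (hC : Subgroup.centralizer (N : Set H) ≤ N) (h3 : 3 ∣ Nat.card H) :
    ∃ S : Subgroup (conjGraph (quaternionRep e)), Nat.card S = 24 ∧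
      (∀ γ ∈ S, γ.1.1 = 1 → γ = 1) ∧ (∀ γ ∈ S, γ.1.2 = 1 → γ = 1) ∧
      (∀ γ ∈ S, γ.1.2.det = 1) ∧ (conjGraphDiag (quaternionRep e)).range ≤ S ∧
      ∃ τ : conjGraph (quaternionRep e), τ ^ 3 = 1 ∧
        S = Subgroup.zpowers τ ⊔ (conjGraphDiag (quaternionRep e)).range := by
  obtain ⟨τ, hτ⟩ := exists_prime_orderOf_dvd_card' (G := conjGraph (quaternionRep e)) 3
    (by rw [card_conjGraph]; exact h3.mul_left 2)
  have hτ3 : τ ^ 3 = 1 := orderOf_dvd_iff_pow_eq_one.1 hτ.dvd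
  set D := (conjGraphDiag (quaternionRep e)).range with hD
  have hDn : D.Normal := conjGraphDiag_range_normal _
  have hDcard : Nat.card D = 8 := by
    have hinj : Function.Injective (conjGraphDiag (quaternionRep e)) := by
      intro m n hmn
      exact Subtype.ext (congrArg (fun γ => γ.1.1) hmn)
    rw [hD, ← Nat.card_congr (MonoidHom.ofInjective hinj).toEquiv, Nat.card_congr e.toEquiv,
      Nat.card_eq_fintype_card, QuaternionGroup.card]
  have hdisj : Disjoint (Subgroup.zpowers τ) D := by
    apply Subgroup.disjoint_of_coprime_natCard
    rw [Nat.card_zpowers, hτ, hDcard]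
    norm_num
  have hrel : D.relIndex (Subgroup.zpowers τ ⊔ D) = 3 := by
    rw [Subgroup.relIndex_sup_right, ← Subgroup.inf_relIndex_left, hdisj.eq_bot,
      Subgroup.relIndex_bot_left, Nat.card_zpowers, hτ]
  have hcard : Nat.card ↥(Subgroup.zpowers τ ⊔ D) = 24 := by
    have := Subgroup.relIndex_mul_relIndex ⊥ D (Subgroup.zpowers τ ⊔ D) bot_le le_sup_right
    rw [Subgroup.relIndex_bot_left, Subgroup.relIndex_bot_left, hDcard, hrel] at this
    exact this.symm
  have hcube : ∀ γ ∈ Subgroup.zpowers τ ⊔ D, γ ^ 3 ∈ D := by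
    intro γ hγ
    rw [← QuotientGroup.eq_one_iff, QuotientGroup.mk_pow]
    have hle : Subgroup.zpowers τ ⊔ D ≤
        (Subgroup.zpowers (QuotientGroup.mk τ : _ ⧸ D)).comap (QuotientGroup.mk' D) := by
      refine sup_le ?_ ?_
      · rw [Subgroup.zpowers_le]
        exact Subgroup.mem_zpowers _
      · intro δ hδ
        rw [Subgroup.mem_comap, QuotientGroup.mk'_apply, (QuotientGroup.eq_one_iff δ).2 hδ]
        exact Subgroup.one_mem _
    obtain ⟨k, hk⟩ := hle hγ
    change (QuotientGroup.mk τ : _ ⧸ D) ^ k = QuotientGroup.mk γ at hk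
    rw [← hk, ← zpow_natCast, ← _root_.zpow_mul, mul_comm, _root_.zpow_mul, zpow_natCast, ← QuotientGroup.mk_pow,
      hτ3, QuotientGroup.mk_one, _root_.one_zpow]
  -- The only other candidate `(1, -1)` equals its own cube, so it would lie in `D`, whose elements
  -- are determined by their first coordinate.
  have hneg : ∀ γ ∈ Subgroup.zpowers τ ⊔ D, γ.1.1 = 1 → γ = 1 := by
    rintro ⟨⟨h, g⟩, hγ⟩ hS hh
    obtain rfl : h = 1 := hh
    rcases eq_one_or_eq_neg_one_of_mem_conjGraph e hγ with rfl | rfl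
    · rfl
    · exfalso
      obtain ⟨n, hn⟩ := hcube _ hS
      have h1 : (n : H) = 1 ^ 3 := congrArg (fun γ => γ.1.1) hn
      rw [one_pow] at h1
      obtain rfl : n = 1 := Subtype.ext h1
      have h2 := congrArg (fun γ => γ.1.2) hn
      rw [map_one] at h2
      apply neg_one_ne_one_GL
      have h3 : (1 : GL (Fin 2) (ZMod 3)) = (-1) ^ 3 := h2
      rw [Odd.neg_one_pow (show Odd 3 by decide)] at h3
      exact h3.symm
  refine ⟨_, hcard, hneg, ?_, ?_, le_sup_right, τ, hτ3, rfl⟩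
  · rintro ⟨⟨h, g⟩, hγ⟩ hS hg
    obtain rfl : g = 1 := hg
    obtain ⟨hhN, -⟩ := mem_of_mem_conjGraph_one e hC hγ
    -- Dividing by the diagonal element over `h` makes the first coordinate trivial, so `hneg` puts
    -- the element itself in the diagonal.
    have h1 : conjGraphDiag (quaternionRep e) ⟨h, hhN⟩ ∈ Subgroup.zpowers τ ⊔ D :=
      (le_sup_right : D ≤ _) ⟨_, rfl⟩
    have h2 := hneg _ (mul_mem hS (inv_mem h1)) (mul_inv_cancel h)
    have h3 : (1 : GL (Fin 2) (ZMod 3)) = quaternionRep e ⟨h, hhN⟩ :=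
      congrArg (fun γ => γ.1.2) (mul_inv_eq_one.1 h2)
    have h4 := quaternionRep_injective e (h3.symm.trans (map_one _).symm)
    obtain rfl : h = 1 := congrArg Subtype.val h4
    rfl
  · let f : conjGraph (quaternionRep e) →* (ZMod 3)ˣ := GeneralLinearGroup.det.comp
      ((MonoidHom.snd _ _).comp (Subgroup.subtype _))
    have hle : Subgroup.zpowers τ ⊔ D ≤ f.ker := by
      refine sup_le ?_ ?_
      · rw [Subgroup.zpowers_le, MonoidHom.mem_ker]
        have h1 : f τ ^ 3 = 1 := by rw [← map_pow, hτ3, map_one]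
        generalize f τ = u at h1
        revert u
        decide
      · rintro _ ⟨n, rfl⟩
        rw [MonoidHom.mem_ker]
        apply Units.ext
        exact det_quaternionMatrix (e n)
    exact fun γ hγ => hle hγ

theorem nonempty_mulEquiv_SL (e : N ≃* QuaternionGroup 2)
    (hC : Subgroup.centralizer (N : Set H) ≤ N) (hH : Nat.card H = 24) :
    Nonempty (H ≃* SpecialLinearGroup (Fin 2) (ZMod 3)) := by
  obtain ⟨S, hS, h1, h2, hdet, -⟩ := exists_subgroup_conjGraph e hC (by rw [hH]; norm_num)
  let f₁ : S →* H := (MonoidHom.fst _ _).comp ((Subgroup.subtype _).comp S.subtype)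
  let f₂ : S →* SpecialLinearGroup (Fin 2) (ZMod 3) := MonoidHom.mk'
    (fun γ => ⟨(γ.1.1.2 : Matrix (Fin 2) (Fin 2) (ZMod 3)), congrArg Units.val (hdet γ γ.2)⟩)
    fun γ δ => rfl
  have hf₁ : Function.Injective f₁ := by
    rw [injective_iff_map_eq_one]
    exact fun γ hγ => Subtype.ext (h1 γ γ.2 hγ)
  have hf₂ : Function.Injective f₂ := by
    rw [injective_iff_map_eq_one]
    exact fun γ hγ => Subtype.ext (h2 γ γ.2 (Units.ext (congrArg Subtype.val hγ)))
  have hb₁ := (Nat.bijective_iff_injective_and_card f₁).2 ⟨hf₁, by rw [hS, hH]⟩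
  have hb₂ := (Nat.bijective_iff_injective_and_card f₂).2 ⟨hf₂, by rw [hS, card_SL_two_three]⟩
  exact ⟨(MulEquiv.ofBijective f₁ hb₁).symm.trans (MulEquiv.ofBijective f₂ hb₂)⟩

/-- With order 48 the second projection of `Γ` is onto as well. The subgroup `S` of order 24 is
normal with quotient of order 4, hence abelian, so `S` contains the commutators of `Γ`, and both
projections are injective on `S`. -/
theorem isIsoclinic_GL (e : N ≃* QuaternionGroup 2)
    (hC : Subgroup.centralizer (N : Set H) ≤ N) (hH : Nat.card H = 48) :
    IsIsoclinic H (GL (Fin 2) (ZMod 3)) := by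
  obtain ⟨S, hS, h1, h2, hdet, hDS, τ, hτ, rfl⟩ :=
    exists_subgroup_conjGraph e hC (by rw [hH]; norm_num)
  set D := (conjGraphDiag (quaternionRep e)).range with hD
  have hDn : D.Normal := conjGraphDiag_range_normal _
  set S := Subgroup.zpowers τ ⊔ D with hSdef
  have hsurj : ∀ g, ∃ h, (h, g) ∈ conjGraph (quaternionRep e) := by
    have htop := Subgroup.eq_top_of_card_eq _
      ((card_range_conjGraph e hC).trans (hH.trans card_GL_two_three.symm))
    intro g
    obtain ⟨⟨⟨h, g'⟩, hγ⟩, rfl⟩ := (htop ▸ Subgroup.mem_top g :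
      g ∈ ((MonoidHom.snd _ _).comp (conjGraph (quaternionRep e)).subtype).range)
    exact ⟨h, hγ⟩
  have hΓ : Nat.card (conjGraph (quaternionRep e)) = 96 := by rw [card_conjGraph, hH]
  let f : conjGraph (quaternionRep e) →* (ZMod 3)ˣ := GeneralLinearGroup.det.comp
      ((MonoidHom.snd _ _).comp (Subgroup.subtype _))
  have hf : Function.Surjective f := by
    intro u
    obtain ⟨h, hγ⟩ := hsurj (GeneralLinearGroup.mkOfDetNeZero !![(u : ZMod 3), 0; 0, 1] (by simp))
    refine ⟨⟨_, hγ⟩, ?_⟩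
    apply Units.ext
    simp [f, GeneralLinearGroup.mkOfDetNeZero]
  have hSf : S ≤ f.ker := fun γ hγ => hdet γ hγ
  have hfcard : Nat.card f.ker = 48 := by
    have h1 := Subgroup.card_eq_card_quotient_mul_card_subgroup f.ker
    rw [Nat.card_congr (QuotientGroup.quotientKerEquivOfSurjective f hf).toEquiv, hΓ] at h1
    have h2 : Nat.card (ZMod 3)ˣ = 2 := by rw [Nat.card_eq_fintype_card]; decide
    rw [h2] at h1
    omega
  have hrel : (S.subgroupOf f.ker).index = 2 := by
    have := Subgroup.relIndex_mul_relIndex ⊥ S f.ker bot_le hSf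
    rw [Subgroup.relIndex_bot_left, Subgroup.relIndex_bot_left, hS, hfcard] at this
    change 24 * (S.subgroupOf f.ker).index = 48 at this
    omega
  have hsq : ∀ γ ∈ f.ker, γ ^ 2 ∈ S := fun γ hγ =>
    Subgroup.sq_mem_of_index_two hrel ⟨γ, hγ⟩
  have hSn : S.Normal := by
    refine ⟨fun γ hγ δ => ?_⟩
    have hle : S ≤ S.comap (MulAut.conj δ).toMonoidHom := by
      refine sup_le ?_ fun x hx => hDS (hDn.conj_mem x hx δ)
      rw [Subgroup.zpowers_le, Subgroup.mem_comap]
      -- Writing `τ` as a square suffices: `S` has index 2 in the normal subgroup of determinant 1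
      -- and so contains all squares from it, conjugates of `τ` included.
      have hττ : τ = (τ ^ 2) ^ 2 := by
        rw [← pow_mul, show 2 * 2 = 3 + 1 from rfl, pow_succ, hτ, one_mul]
      rw [hττ, map_pow]
      apply hsq
      have : f.ker.Normal := inferInstance
      exact this.conj_mem _ (pow_mem (hSf (Subgroup.mem_sup_left (Subgroup.mem_zpowers τ))) 2) δ
    exact hle hγ
  have hcomm : commutator (conjGraph (quaternionRep e)) ≤ S := by
    have hq : Nat.card (conjGraph (quaternionRep e) ⧸ S) = 2 ^ 2 := by
      have h1 := Subgroup.card_eq_card_quotient_mul_card_subgroup S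
      rw [hΓ, hS] at h1
      omega
    rw [commutator_def, Subgroup.commutator_le]
    intro γ _ δ _
    rw [← QuotientGroup.eq_one_iff]
    have h3 := map_commutatorElement (QuotientGroup.mk' S) γ δ
    rw [QuotientGroup.mk'_apply] at h3
    rw [h3, commutatorElement_eq_one_iff_mul_comm]
    exact (IsPGroup.isMulCommutative_of_card_eq_prime_sq hq).is_comm.comm _ _
  refine isIsoclinic_of_subgroup _ (exists_mem_conjGraph_quaternionRep e) hsurj fun γ hγ => ?_
  constructor
  · intro h
    rw [h1 γ (hcomm hγ) h]; rfl
  · intro h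
    rw [h2 γ (hcomm hγ) h]; rfl

end Eight

end QuaternionRepresentation

/-! ### Classification when there is no odd-order normal subgroup. -/

theorem isPGroup_of_forall_odd_eq_one {H : Type*} [Group H] [Finite H]
    (h : ∀ (t : H) (m : ℕ), Odd m → t ^ m = 1 → t = 1) : IsPGroup 2 H := by
  apply IsPGroup.of_card (n := (Nat.card H).primeFactorsList.length)
  refine Nat.eq_prime_pow_of_unique_prime_dvd Nat.card_pos.ne' ?_
  intro q hq hqH
  by_contra hq2
  have := Fact.mk hq
  obtain ⟨t, ht⟩ := exists_prime_orderOf_dvd_card' q hqH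
  have := h t q (hq.odd_of_ne_two hq2) (orderOf_dvd_iff_pow_eq_one.1 ht.dvd)
  rw [this, orderOf_one] at ht
  exact hq.one_lt.ne ht

/-- Finite solvable groups with generalised quaternion Sylow `2`-subgroups and without nontrivial
normal subgroups of odd order. -/
theorem isPGroup_or_SL_or_tildeGL {H : Type*} [Group H] [Finite H] [Group.IsSolvable H]
    (hO : ∀ M : Subgroup H, M.Normal → (Nat.card M).Coprime 2 → M = ⊥) (P : Sylow 2 H)
    (hP : IsGeneralizedQuaternion P) :
    IsPGroup 2 H ∨ Nonempty (H ≃* Matrix.SpecialLinearGroup (Fin 2) (ZMod 3)) ∨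
      IsTildeGL23 H := by
  obtain ⟨z, hz1, hz2, -, hzu, -⟩ := hP.exists_involution
  let N : Subgroup H := sSup {M : Subgroup H | M.Normal ∧ IsPGroup 2 M}
  have hNn : N.Normal := Subgroup.sSup_normal _ fun _ h => h.1
  have hN2 : IsPGroup 2 N := Sylow.sSup_of_normal _ (fun _ h => h.2) fun _ h => h.1
  have hC : Subgroup.centralizer (N : Set H) ≤ N :=
    centralizer_le_of_isSolvable hO N fun M h1 h2 => le_sSup ⟨h1, h2⟩
  have hNP : N ≤ P := hN2.le_sylow_of_normal P
  have hu : ∀ y : N, y ^ 2 = 1 → y = 1 ∨ (y : H) = z := by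
    intro y hy2
    have hy2' : (y : H) ^ 2 = 1 := congrArg Subtype.val hy2
    rcases hzu ⟨y, hNP y.2⟩ (Subtype.ext hy2') with h | h
    · have h' : (y : H) = 1 := congrArg Subtype.val h
      exact Or.inl (Subtype.ext h')
    · exact Or.inr (congrArg Subtype.val h)
  -- Odd-order elements centralising `N` lie in the 2-group `N`, so they are trivial.
  have hodd : (∀ (t : H) (m : ℕ), Odd m → t ^ m = 1 →
      t ∈ Subgroup.centralizer (N : Set H)) → IsPGroup 2 H := by
    intro h
    apply isPGroup_of_forall_odd_eq_one
    intro t m hm htm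
    obtain ⟨k, hk⟩ := isPGroup_iff_pow_pow_eq_one.1 hN2 ⟨t, hC (h t m hm htm)⟩
    exact eq_one_of_pow_odd_of_pow_two_pow hm htm (congrArg Subtype.val hk)
  rcases isCyclic_or_isGeneralizedQuaternion hN2 (by
    intro x y hx hx1 hy
    have hxz := (hu x hx).resolve_left hx1
    rcases hu y hy with rfl | hyz
    · exact Subgroup.one_mem _
    · rw [Subtype.ext (hyz.trans hxz.symm)]
      exact Subgroup.mem_zpowers x) with hcyc | ⟨-, n, hn, ⟨e⟩⟩
  · left
    apply hodd
    intro t m hm htm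
    obtain ⟨a, ha⟩ := hcyc.exists_generator
    obtain ⟨n, hn⟩ := IsPGroup.iff_orderOf.1 hN2 a
    have hta : t * a = a * t := by
      refine commute_of_odd_of_isCyclic hm htm ((Subgroup.orderOf_coe a).trans hn) ?_
      obtain ⟨k, hk⟩ := ha ⟨t * a * t⁻¹, hNn.conj_mem a a.2 t⟩
      exact ⟨k, congrArg Subtype.val hk⟩
    rw [Subgroup.mem_centralizer_iff]
    intro y hy
    obtain ⟨k, hk⟩ := ha ⟨y, hy⟩
    have hk' : (a : H) ^ k = y := congrArg Subtype.val hk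
    rw [← hk']
    exact ((show Commute t (a : H) from hta).zpow_right k).eq.symm
  rcases Nat.lt_or_ge 1 n with hn2 | hn1
  · left
    exact hodd fun t m hm htm => commute_of_odd_of_quaternion N hn2 e hm htm
  obtain rfl : n = 1 := by omega
  have e : N ≃* QuaternionGroup 2 := e
  have h48 := card_dvd_of_centralizer_le e hC
  have h8 : 8 ∣ Nat.card H := by
    have := Subgroup.card_subgroup_dvd_card N
    rwa [Nat.card_congr e.toEquiv, Nat.card_eq_fintype_card, QuaternionGroup.card] at this
  obtain ⟨m, hm⟩ := h8
  have hm6 : m ∣ 6 := by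
    rw [hm] at h48
    exact (Nat.mul_dvd_mul_iff_left (by norm_num : 0 < 8)).1 h48
  have hm6' : m ≤ 6 := Nat.le_of_dvd (by norm_num) hm6
  have : m = 1 ∨ m = 2 ∨ m = 3 ∨ m = 6 := by
    interval_cases m <;> omega
  rcases this with rfl | rfl | rfl | rfl
  · exact Or.inl (IsPGroup.of_card (n := 3) hm)
  · exact Or.inl (IsPGroup.of_card (n := 4) hm)
  · exact Or.inr (Or.inl (nonempty_mulEquiv_SL e hC hm))
  · refine Or.inr (Or.inr ⟨hm, isIsoclinic_GL e hC hm, fun S => ⟨hP.congr (P.equiv S), ?_⟩⟩)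
    have h16 : (48 : ℕ).factorization 2 = 4 := by
      rw [show 48 = 2 ^ 4 * 3 by norm_num, Nat.factorization_mul (by norm_num) (by norm_num),
        Nat.Prime.factorization_pow Nat.prime_two, Finsupp.add_apply, Finsupp.single_eq_same,
        Nat.factorization_eq_zero_of_not_dvd (by norm_num)]
    have := S.card_eq_multiplicity
    rw [hm, show 8 * 6 = 48 by norm_num, h16] at this
    exact this

/-- There is a unique involution, and it generates the center. -/
def HasCentralInvolution (H : Type*) [Group H] : Prop :=
  ∃ z : H, z ≠ 1 ∧ z ^ 2 = 1 ∧ z ∈ Subgroup.center H ∧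
    (∀ y : H, y ^ 2 = 1 → y = 1 ∨ y = z) ∧ ∀ y ∈ Subgroup.center H, y = 1 ∨ y = z

theorem HasCentralInvolution.congr {H H' : Type*} [Group H] [Group H'] (e : H ≃* H')
    (h : HasCentralInvolution H) : HasCentralInvolution H' := by
  obtain ⟨z, hz1, hz2, hzc, hzu, hzz⟩ := h
  refine ⟨e z, by simpa using hz1, by rw [← map_pow, hz2, map_one], ?_, ?_, ?_⟩
  · rw [Subgroup.mem_center_iff]
    intro g
    obtain ⟨g, rfl⟩ := e.surjective g
    rw [← map_mul, ← map_mul, Subgroup.mem_center_iff.1 hzc]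
  · intro y hy
    obtain ⟨y, rfl⟩ := e.surjective y
    rw [← map_pow, MulEquiv.map_eq_one_iff] at hy
    simpa using hzu y hy
  · intro y hy
    obtain ⟨y, rfl⟩ := e.surjective y
    have : y ∈ Subgroup.center H := by
      rw [Subgroup.mem_center_iff] at hy ⊢
      intro g
      apply e.injective
      rw [map_mul, map_mul, hy]
    simpa using hzz y this

/-! ### Central involutions of the exceptional quotients, and their lifting. -/

section Matrices

open Matrix

theorem card_center_GL_two_three : Nat.card (Subgroup.center (GL (Fin 2) (ZMod 3))) = 2 := by
  have horder : orderOf (-1 : GL (Fin 2) (ZMod 3)) = 2 :=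
    orderOf_eq_prime (by simp) neg_one_ne_one_GL
  have : Subgroup.center (GL (Fin 2) (ZMod 3)) = Subgroup.zpowers (-1) := by
    apply le_antisymm
    · intro g hg
      rcases centralizer_quaternionMatrix_GL (g := g) (fun q => (congrArg Units.val
        (Subgroup.mem_center_iff.1 hg (quaternionMatrix.toHomUnits q))).symm) with rfl | rfl
      · exact Subgroup.one_mem _
      · exact Subgroup.mem_zpowers _
    · rw [Subgroup.zpowers_le, Subgroup.mem_center_iff]
      intro g
      simp
  rw [this, Nat.card_zpowers, horder]

theorem sq_eq_one_SL_two_three : ∀ a b c d : ZMod 3, a * d - b * c = 1 →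
    !![a, b; c, d] * !![a, b; c, d] = 1 → !![a, b; c, d] = 1 ∨ !![a, b; c, d] = -1 := by
  decide +kernel

theorem hasCentralInvolution_SL :
    HasCentralInvolution (SpecialLinearGroup (Fin 2) (ZMod 3)) := by
  refine ⟨-1, ?_, by simp, ?_, ?_, ?_⟩
  · intro h
    have h1 := congrArg (fun g : SpecialLinearGroup (Fin 2) (ZMod 3) =>
      (g : Matrix (Fin 2) (Fin 2) (ZMod 3)) 0 0) h
    revert h1
    decide
  · rw [Subgroup.mem_center_iff]
    intro g
    simp
  · rintro ⟨A, hA⟩ h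
    have h1 : A * A = 1 := by
      rw [← sq]
      exact congrArg Subtype.val h
    rw [det_fin_two] at hA
    rw [eta_fin_two A] at h1
    rcases sq_eq_one_SL_two_three _ _ _ _ hA h1 with h2 | h2
    · left; exact Subtype.ext ((eta_fin_two A).trans h2)
    · right; exact Subtype.ext ((eta_fin_two A).trans h2)
  · rintro ⟨A, hA⟩ h
    have h1 : ∀ q, A * quaternionMatrix q = quaternionMatrix q * A := fun q =>
      (congrArg Subtype.val
        (Subgroup.mem_center_iff.1 h ⟨quaternionMatrix q, det_quaternionMatrix q⟩)).symm
    rcases centralizer_quaternionMatrix_GL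
      (g := GeneralLinearGroup.mkOfDetNeZero A (by rw [hA]; decide)) h1 with h2 | h2
    · left; exact Subtype.ext (congrArg Units.val h2)
    · right; exact Subtype.ext (congrArg Units.val h2)

/-- Isoclinic groups have isomorphic central quotients; as both orders are 48, the centers have
equal order. -/
theorem IsTildeGL23.card_center {H : Type*} [Group H] (h : IsTildeGL23 H) :
    Nat.card (Subgroup.center H) = 2 := by
  obtain ⟨hcard, ⟨φ, -, -⟩, -⟩ := h
  have h1 := Subgroup.card_eq_card_quotient_mul_card_subgroup (Subgroup.center H)
  have h2 := Subgroup.card_eq_card_quotient_mul_card_subgroup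
    (Subgroup.center (GL (Fin 2) (ZMod 3)))
  rw [card_GL_two_three, card_center_GL_two_three] at h2
  rw [Nat.card_congr φ.toEquiv, hcard] at h1
  have h3 : Nat.card (GL (Fin 2) (ZMod 3) ⧸ Subgroup.center (GL (Fin 2) (ZMod 3))) = 24 := by omega
  change 48 = Nat.card (GL (Fin 2) (ZMod 3) ⧸ Subgroup.center (GL (Fin 2) (ZMod 3))) * _ at h1
  rw [h3] at h1
  omega

end Matrices

/-- A central element of order `p` lies in every Sylow `p`-subgroup. -/
theorem mem_sylow_of_mem_center {G : Type*} [Group G] {p : ℕ} [Fact p.Prime]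
    {x : G} (hx : x ∈ Subgroup.center G) (hxp : x ^ p = 1) (P : Sylow p G) : x ∈ P := by
  have hn : (Subgroup.zpowers x).Normal := by
    refine ⟨?_⟩
    rintro _ ⟨k, rfl⟩ g
    have := (Subgroup.mem_center_iff.1 ((Subgroup.center G).zpow_mem hx k)) g
    change g * x ^ k * g⁻¹ ∈ _
    rw [this, mul_inv_cancel_right]
    exact ⟨k, rfl⟩
  have hpg : IsPGroup p (Subgroup.zpowers x) := by
    apply IsPGroup.of_card_dvd_pow (n := 1)
    rw [Nat.card_zpowers, pow_one]
    exact orderOf_dvd_of_pow_eq_one hxp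
  exact hpg.le_sylow_of_normal P (Subgroup.mem_zpowers x)

theorem exists_conj_mem_sylow {G : Type*} [Group G] [Finite G] {p : ℕ} [hp : Fact p.Prime]
    {y : G} (hy : y ^ p = 1) (P : Sylow p G) : ∃ g : G, g * y * g⁻¹ ∈ P := by
  have hpg : IsPGroup p (Subgroup.zpowers y) := by
    apply IsPGroup.of_card_dvd_pow (n := 1)
    rw [Nat.card_zpowers, pow_one]
    exact orderOf_dvd_of_pow_eq_one hy
  obtain ⟨Q, hQ⟩ := hpg.exists_le_sylow
  obtain ⟨g, rfl⟩ := MulAction.exists_smul_eq G Q P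
  refine ⟨g, ?_⟩
  rw [← SetLike.mem_coe, Sylow.coe_smul]
  exact Set.smul_mem_smul_set (a := MulAut.conj g) (hQ (Subgroup.mem_zpowers y))

/-- A central involution lies in a Sylow 2-subgroup, where it is the only involution; every
involution is conjugate into that subgroup, hence equal to the central one. -/
theorem IsTildeGL23.hasCentralInvolution {H : Type*} [Group H] (h : IsTildeGL23 H) :
    HasCentralInvolution H := by
  have hfin : Finite H := Nat.finite_of_card_ne_zero (by rw [h.1]; norm_num)
  have hc := h.card_center
  obtain ⟨⟨w, hwc⟩, hw⟩ := exists_prime_orderOf_dvd_card' (G := Subgroup.center H) 2 hc.symm.dvd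
  rw [Subgroup.orderOf_mk] at hw
  have hw2 : w ^ 2 = 1 := orderOf_dvd_iff_pow_eq_one.1 hw.dvd
  have hw1 : w ≠ 1 := by
    rintro rfl
    simp at hw
  refine ⟨w, hw1, hw2, hwc, ?_, ?_⟩
  · obtain ⟨S⟩ : Nonempty (Sylow 2 H) := inferInstance
    obtain ⟨z, hz1, hz2, -, hzu, -⟩ := (h.2.2 S).1.exists_involution
    have hu : ∀ y ∈ S, y ^ 2 = 1 → y = 1 ∨ y = z := by
      intro y hy hy2
      rcases hzu ⟨y, hy⟩ (Subtype.ext hy2) with h | h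
      · exact Or.inl (congrArg Subtype.val h)
      · exact Or.inr (congrArg Subtype.val h)
    have hwz := (hu w (mem_sylow_of_mem_center hwc hw2 S) hw2).resolve_left hw1
    intro y hy
    obtain ⟨g, hg⟩ := exists_conj_mem_sylow hy S
    rcases hu _ hg (by rw [conj_pow, hy, mul_one, mul_inv_cancel]) with h1 | h1
    · left
      simpa using h1
    · right
      rw [← hwz, mul_inv_eq_iff_eq_mul, ← Subgroup.mem_center_iff.1 hwc g] at h1
      exact mul_left_cancel h1
  · intro y hy
    by_contra! hcon
    have hsub : ({1, w, y} : Set H) ⊆ Subgroup.center H := by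
      rintro _ (rfl | rfl | rfl)
      exacts [Subgroup.one_mem _, hwc, hy]
    have h1 := Set.ncard_le_ncard hsub (Set.toFinite _)
    rw [Set.ncard_eq_three.2 ⟨1, w, y, hw1.symm, hcon.1.symm, hcon.2.symm, rfl⟩] at h1
    have h2 : (Subgroup.center H : Set H).ncard = 2 := hc
    omega

/-- Lifting a central involution through a normal subgroup `M` of odd order. -/
theorem exists_central_involution {G : Type*} [Group G] [Finite G] (P : Sylow 2 G)
    (M : Subgroup G) [hM : M.Normal] (hMc : (Nat.card M).Coprime 2)
    (hH : HasCentralInvolution (G ⧸ M))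
    (hZ : centerOf (P : Subgroup G) ≤ centralizerIn (P : Subgroup G) M) :
    ∃ z ∈ Subgroup.center G, z ≠ 1 ∧ z ^ 2 = 1 ∧ (∀ y : G, y ^ 2 = 1 → y = 1 ∨ y = z) ∧
      ∀ y ∈ Subgroup.center G, y ^ 4 = 1 → y = 1 ∨ y = z := by
  have hM1 := (coprime_card_iff M).1 hMc
  have hM4 : ∀ y ∈ M, y ^ 4 = 1 → y = 1 := fun y hy h =>
    hM1 y hy (hM1 _ (pow_mem hy 2) (by rwa [← pow_mul]))
  obtain ⟨w, hw1, hw2, hwc, hwu, hwz⟩ := hH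
  have hG2 : 2 ∣ Nat.card G := by
    refine dvd_trans ?_ (Subgroup.card_quotient_dvd_card M)
    rw [← orderOf_eq_prime hw2 hw1]
    exact orderOf_dvd_natCard w
  have hPnt : Nontrivial P := (Subgroup.nontrivial_iff_ne_bot _).2 (P.ne_bot_of_dvd_card hG2)
  have hcnt := P.isPGroup'.center_nontrivial
  obtain ⟨⟨⟨z, hzP⟩, hzc⟩, hz⟩ := exists_prime_orderOf_dvd_card'
    (G := Subgroup.center P) 2
    (((P.isPGroup'.to_subgroup (Subgroup.center P)).card_eq_or_dvd).resolve_left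
      Finite.one_lt_card.ne')
  rw [Subgroup.orderOf_mk, Subgroup.orderOf_mk] at hz
  have hz2 : z ^ 2 = 1 := orderOf_dvd_iff_pow_eq_one.1 hz.dvd
  have hz1 : z ≠ 1 := by
    rintro rfl
    simp at hz
  have hzM : ∀ m ∈ M, m * z = z * m := fun m hm =>
    Subgroup.mem_centralizer_iff.1 (hZ ⟨_, hzc, rfl⟩).2 m hm
  have hzMn : z ∉ M := fun h => hz1 (hM1 z h hz2)
  have hzw : (z : G ⧸ M) = w := (hwu z (by rw [← QuotientGroup.mk_pow, hz2]; rfl)).resolve_left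
    fun h => hzMn ((QuotientGroup.eq_one_iff z).1 h)
  -- `y * z⁻¹` lies in `M`, hence commutes with `z`, so its square is 1; odd order makes it trivial.
  have key : ∀ y : G, y ^ 2 = 1 → (y : G ⧸ M) = z → y = z := by
    intro y hy hyz
    have hm : y * z⁻¹ ∈ M := by
      rw [← QuotientGroup.eq_one_iff, QuotientGroup.mk_mul, QuotientGroup.mk_inv, hyz,
        mul_inv_cancel]
    have hcomm : Commute (y * z⁻¹) z := hzM _ hm
    have h1 : (y * z⁻¹) ^ 2 = 1 := by
      have := hcomm.mul_pow 2
      rw [inv_mul_cancel_right, hy, hz2, mul_one] at this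
      exact this.symm
    exact mul_inv_eq_one.1 (hM1 _ hm h1)
  have hzcen : z ∈ Subgroup.center G := by
    rw [Subgroup.mem_center_iff]
    intro g
    have h1 := key (g * z * g⁻¹) (by rw [conj_pow, hz2, mul_one, mul_inv_cancel]) (by
      rw [QuotientGroup.mk_mul, QuotientGroup.mk_mul, QuotientGroup.mk_inv, hzw,
        Subgroup.mem_center_iff.1 hwc, mul_inv_cancel_right])
    rwa [mul_inv_eq_iff_eq_mul] at h1
  refine ⟨z, hzcen, hz1, hz2, ?_, ?_⟩
  · intro y hy
    rcases hwu y (by rw [← QuotientGroup.mk_pow, hy]; rfl) with h | h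
    · exact Or.inl (hM1 y ((QuotientGroup.eq_one_iff y).1 h) hy)
    · exact Or.inr (key y hy (h.trans hzw.symm))
  · intro y hy hy4
    have hyc : (y : G ⧸ M) ∈ Subgroup.center (G ⧸ M) := by
      rw [Subgroup.mem_center_iff]
      intro g
      obtain ⟨g, rfl⟩ := QuotientGroup.mk_surjective g
      rw [← QuotientGroup.mk_mul, ← QuotientGroup.mk_mul, Subgroup.mem_center_iff.1 hy]
    rcases hwz _ hyc with h | h
    · exact Or.inl (hM4 y ((QuotientGroup.eq_one_iff y).1 h) hy4)
    · right
      have hm : y * z⁻¹ ∈ M := by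
        rw [← QuotientGroup.eq_one_iff, QuotientGroup.mk_mul, QuotientGroup.mk_inv, h, hzw,
          mul_inv_cancel]
      have hcomm : Commute y z⁻¹ := (Subgroup.mem_center_iff.1 hy z⁻¹).symm
      refine mul_inv_eq_one.1 (hM4 _ hm ?_)
      rw [hcomm.mul_pow, hy4, one_mul, inv_pow, show 4 = 2 * 2 from rfl, pow_mul, hz2, one_pow,
        inv_one]

/-- A Sylow `p`-subgroup is isomorphic to its image modulo a normal `p'`-subgroup. -/
theorem nonempty_mulEquiv_mapSurjective {G : Type*} [Group G] [Finite G] {p : ℕ} [Fact p.Prime]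
    (P : Sylow p G) (M : Subgroup G) [M.Normal] (hM : (Nat.card M).Coprime p) :
    Nonempty (P ≃* P.mapSurjective (QuotientGroup.mk'_surjective M)) := by
  let f := (QuotientGroup.mk' M).subgroupMap (P : Subgroup G)
  have hf : Function.Bijective f := by
    refine ⟨?_, (QuotientGroup.mk' M).subgroupMap_surjective _⟩
    rw [injective_iff_map_eq_one]
    rintro ⟨x, hx⟩ h
    have h1 : (x : G ⧸ M) = 1 := congrArg Subtype.val h
    rw [QuotientGroup.eq_one_iff] at h1
    have h2 := (disjoint_of_isPGroup_of_coprime P.isPGroup' hM).le_bot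
      (Subgroup.mem_inf.2 ⟨hx, h1⟩)
    exact Subtype.ext h2
  exact ⟨(MulEquiv.ofBijective f hf).trans (MulEquiv.subgroupCongr (Sylow.coe_mapSurjective _ P).symm)⟩

theorem quaternion_cases {G : Type*} [Group G] [Finite G] [Group.IsSolvable G] (P : Sylow 2 G)
    (hP : IsGeneralizedQuaternion P) {z : G} (hz : z ∈ Subgroup.center G)
    (hzu : ∀ y : G, y ^ 2 = 1 → y ∈ Subgroup.zpowers z) :
    QuaternionWithComplement (P : Subgroup G) ∨ ExceptionalQuotient (P : Subgroup G) := by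
  set O := pPrimeCore 2 G with hO
  have hOc : (Nat.card O).Coprime 2 := coprime_card_pPrimeCore G 2
  have hZ : centerOf (P : Subgroup G) ≤ centralizerIn (P : Subgroup G) O := by
    obtain ⟨w, -, hw2, -, -, hwz⟩ := hP.exists_involution
    rintro _ ⟨y, hy, rfl⟩
    refine ⟨y.2, ?_⟩
    have hy2 : (y : G) ^ 2 = 1 := by
      have h1 : y ^ 2 = 1 := by
        rcases hwz y hy with rfl | rfl
        · exact one_pow 2
        · exact hw2
      exact congrArg Subtype.val h1
    have hyc : (y : G) ∈ Subgroup.center G := (Subgroup.zpowers_le.2 hz) (hzu _ hy2)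
    exact Subgroup.center_le_centralizer _ hyc
  obtain ⟨e⟩ := nonempty_mulEquiv_mapSurjective P O hOc
  rcases isPGroup_or_SL_or_tildeGL
      (fun M hM hMc => eq_bot_of_coprime_quotient_pPrimeCore M hMc)
      (P.mapSurjective (QuotientGroup.mk'_surjective O)) (hP.congr e) with h | h | h
  · left
    refine ⟨hP, O, inferInstance, ?_, hZ⟩
    apply Subgroup.isComplement'_of_card_mul_and_disjoint
    -- The quotient is a 2-group, so it equals the image of `P`, which is isomorphic to `P`.
    · have htop := (P.mapSurjective (QuotientGroup.mk'_surjective O)).is_maximal' (Q := ⊤)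
        (h.to_subgroup _) le_top
      have h1 := Nat.card_congr e.toEquiv
      change Nat.card P = Nat.card ↥(P.mapSurjective (QuotientGroup.mk'_surjective O)).toSubgroup
        at h1
      rw [← htop, Subgroup.card_top] at h1
      rw [Subgroup.card_eq_card_quotient_mul_card_subgroup O, ← h1, mul_comm]
    · exact (disjoint_of_isPGroup_of_coprime P.isPGroup' hOc).symm
  · exact Or.inr ⟨hZ, Or.inl h⟩
  · exact Or.inr ⟨hZ, Or.inr h⟩

theorem exists_central_involution_of_cases {G : Type*} [Group G] [Finite G] (P : Sylow 2 G)
    (h : QuaternionWithComplement (P : Subgroup G) ∨ ExceptionalQuotient (P : Subgroup G)) :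
    ∃ z ∈ Subgroup.center G, z ≠ 1 ∧ z ^ 2 = 1 ∧ (∀ y : G, y ^ 2 = 1 → y = 1 ∨ y = z) ∧
      ∀ y ∈ Subgroup.center G, y ^ 4 = 1 → y = 1 ∨ y = z := by
  rcases h with ⟨hq, Q, hQn, hQ, hZ⟩ | ⟨hZ, h⟩
  · refine exists_central_involution P Q ?_ ?_ hZ
    · have h1 : Q.index = Nat.card P := hQ.symm.index_eq_card
      have h2 := P.not_dvd_index
      have h3 : (P : Subgroup G).index = Nat.card Q := hQ.index_eq_card
      rw [h3] at h2
      exact ((Nat.Prime.coprime_iff_not_dvd Nat.prime_two).2 h2).symm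
    · exact HasCentralInvolution.congr (hQ.symm.QuotientMulEquiv).symm hq.exists_involution
  · refine exists_central_involution P _ (coprime_card_pPrimeCore G 2) ?_ hZ
    rcases h with ⟨⟨e⟩⟩ | h
    · exact hasCentralInvolution_SL.congr e.symm
    · exact h.hasCentralInvolution

/-! ### The 2-part and the divisibility by 3 of `|K(G)|`. -/

/-- A subgroup of order 4 in `K(G)` would be central of exponent dividing 4, hence inside `{1, z}`.
-/
theorem two_pow_factorization_card_K {G : Type*} [Group G] [Finite G] {z : G}
    (hzc : z ∈ Subgroup.center G) (hz1 : z ≠ 1) (hz2 : z ^ 2 = 1)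
    (hzu : ∀ y : G, y ^ 2 = 1 → y = 1 ∨ y = z)
    (hz4 : ∀ y ∈ Subgroup.center G, y ^ 4 = 1 → y = 1 ∨ y = z) :
    2 ^ (Nat.card (K G)).factorization 2 = 2 := by
  have h2 : 2 ∣ Nat.card (K G) := prime_dvd_card_K_iff.2 ⟨z, hzc, hz1, hz2, fun y hy => by
    rcases hzu y hy with rfl | rfl
    · exact Subgroup.one_mem _
    · exact Subgroup.mem_zpowers _⟩
  have h4 : ¬ 2 ^ 2 ∣ Nat.card (K G) := by
    intro h
    rw [card_K] at h
    obtain ⟨S, hS⟩ := Sylow.exists_subgroup_card_pow_prime 2 h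
    have hsub : ((S.map (cyclicizer G).subtype : Subgroup G) : Set G) ⊆ {1, z} := by
      rintro _ ⟨y, hy, rfl⟩
      have hy4 : y ^ 4 = 1 := by
        have := pow_card_eq_one' (x := (⟨y, hy⟩ : S))
        rw [hS] at this
        exact congrArg Subtype.val this
      exact hz4 _ (cyclicizer_le_center y.2) (congrArg Subtype.val hy4)
    have h1 := Set.ncard_le_ncard hsub (Set.toFinite _)
    have h3 : ((S.map (cyclicizer G).subtype : Subgroup G) : Set G).ncard = 4 := by
      change Nat.card (S.map (cyclicizer G).subtype) = 4
      rw [Subgroup.card_map_of_injective (Subgroup.subtype_injective _), hS]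
      norm_num
    have := Set.ncard_pair hz1.symm
    omega
  have hpos : Nat.card (K G) ≠ 0 := by rw [card_K]; exact Nat.card_pos.ne'
  have h5 : (Nat.card (K G)).factorization 2 = 1 := by
    have h6 := (Nat.Prime.dvd_iff_one_le_factorization Nat.prime_two hpos).1 h2
    have h7 := mt (Nat.Prime.pow_dvd_iff_le_factorization Nat.prime_two hpos).2 h4
    omega
  rw [h5, pow_one]

section Three

open Matrix

/-- In `PGL₂(3)` there is an element of order three that is conjugate to its inverse. -/
theorem exists_inverted_PGL : ∃ u v : GL (Fin 2) (ZMod 3) ⧸ Subgroup.center (GL (Fin 2) (ZMod 3)),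
    u ≠ 1 ∧ u ^ 3 = 1 ∧ v * u * v⁻¹ = u⁻¹ := by
  let U : GL (Fin 2) (ZMod 3) := ⟨!![1, 1; 0, 1], !![1, -1; 0, 1], by decide, by decide⟩
  let W : GL (Fin 2) (ZMod 3) := ⟨!![1, 0; 1, 1], !![1, 0; -1, 1], by decide, by decide⟩
  let V : GL (Fin 2) (ZMod 3) := ⟨!![1, 0; 0, -1], !![1, 0; 0, -1], by decide, by decide⟩
  refine ⟨U, V, ?_, ?_, ?_⟩
  · rw [Ne, QuotientGroup.eq_one_iff, Subgroup.mem_center_iff]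
    intro h
    have := congrArg Units.val (h W)
    revert this
    change ¬ (!![1, 0; 1, 1] * !![1, 1; 0, 1] : Matrix (Fin 2) (Fin 2) (ZMod 3)) =
      !![1, 1; 0, 1] * !![1, 0; 1, 1]
    decide
  · rw [← QuotientGroup.mk_pow, (show U ^ 3 = 1 from Units.ext (by
      rw [Units.val_pow_eq_pow_val]
      change (!![1, 1; 0, 1] : Matrix (Fin 2) (Fin 2) (ZMod 3)) ^ 3 = 1
      decide)), QuotientGroup.mk_one]
  · rw [← QuotientGroup.mk_inv, ← QuotientGroup.mk_inv, ← QuotientGroup.mk_mul,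
      ← QuotientGroup.mk_mul, (show V * U * V⁻¹ = U⁻¹ from Units.ext (by
        change (!![1, 0; 0, -1] * !![1, 1; 0, 1] * !![1, 0; 0, -1] :
          Matrix (Fin 2) (Fin 2) (ZMod 3)) = !![1, -1; 0, 1]
        decide))]

theorem card_PGL_two_three :
    Nat.card (GL (Fin 2) (ZMod 3) ⧸ Subgroup.center (GL (Fin 2) (ZMod 3))) = 24 := by
  have h := Subgroup.card_eq_card_quotient_mul_card_subgroup
    (Subgroup.center (GL (Fin 2) (ZMod 3)))
  rw [card_GL_two_three, card_center_GL_two_three] at h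
  omega

end Three

/-- The subgroup of order `p` of a group with a central element `x` generating all elements of
order `p` determines the structure of the Sylow `p`-subgroups. -/
theorem sylow_isCyclic_or_isGeneralizedQuaternion {G : Type*} [Group G] [Finite G] {p : ℕ}
    [Fact p.Prime] {x : G} (hxp : x ^ p = 1)
    (hx : ∀ y : G, y ^ p = 1 → y ∈ Subgroup.zpowers x) (P : Sylow p G) :
    IsCyclic P ∨ (p = 2 ∧ IsGeneralizedQuaternion P) := by
  apply isCyclic_or_isGeneralizedQuaternion P.isPGroup'
  intro y w hy hy1 hw
  have hy' : (y : G) ^ p = 1 := congrArg Subtype.val hy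
  have hw' : (w : G) ^ p = 1 := congrArg Subtype.val hw
  have h1 := mem_zpowers_symm_of_pow_eq_one hxp (fun h => hy1 (Subtype.ext h)) (hx _ hy')
  obtain ⟨k, hk⟩ := (Subgroup.zpowers_le.2 h1) (hx _ hw')
  exact ⟨k, Subtype.ext hk⟩

/-- If a group maps onto a group with Sylow `p`-subgroups of order `p`, an element of order `p` of
which is inverted, then a cyclic Sylow `p`-subgroup contains no nontrivial central element. -/
theorem sq_eq_one_of_inverted {G T : Type*} [Group G] [Finite G] [Group T] {p : ℕ}
    [hp : Fact p.Prime] (f : G →* T) (hf : Function.Surjective f)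
    (hT : (Nat.card T).factorization p = 1) {u v : T} (hu1 : u ≠ 1) (hup : u ^ p = 1)
    (hv : v * u * v⁻¹ = u⁻¹) {c : G} (hc : c ∈ Subgroup.center G) (hcp : c ^ p = 1)
    (hcyc : ∀ P : Sylow p G, IsCyclic P) : c ^ 2 = 1 := by
  have hTf : Finite T := Finite.of_surjective f hf
  have hou := orderOf_eq_prime hup hu1
  obtain ⟨Q, hQ⟩ := (IsPGroup.of_card_dvd_pow (p := p) (n := 1) (G := Subgroup.zpowers u) (by
    rw [Nat.card_zpowers, hou, pow_one])).exists_le_sylow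
  have hQu : Subgroup.zpowers u = Q := by
    apply Subgroup.eq_of_le_of_card_ge hQ
    rw [Nat.card_zpowers, hou]
    have := Q.card_eq_multiplicity
    rw [hT, pow_one] at this
    exact this.le
  obtain ⟨R, rfl⟩ := Sylow.mapSurjective_surjective hf p Q
  rw [Sylow.coe_mapSurjective] at hQu
  obtain ⟨⟨r, hrR⟩, hr⟩ := (hcyc R).exists_generator
  obtain ⟨g, rfl⟩ := hf v
  set B := (Subgroup.zpowers u).comap f with hB
  have hRB : (R : Subgroup G) ≤ B := by
    rw [hB, hQu]
    exact Subgroup.le_comap_map _ _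
  have hgRB : ((g • R : Sylow p G) : Subgroup G) ≤ B := by
    intro y hy
    rw [Sylow.coe_subgroup_smul] at hy
    obtain ⟨x, hx, rfl⟩ := hy
    obtain ⟨k, hk⟩ : f x ∈ Subgroup.zpowers u := hRB hx
    change f (g * x * g⁻¹) ∈ Subgroup.zpowers u
    have hk' : u ^ k = f x := hk
    rw [map_mul, map_mul, map_inv, ← hk', ← conj_zpow, hv]
    exact zpow_mem (inv_mem (Subgroup.mem_zpowers u)) k
  -- Frattini argument: `R` and its conjugate by `g` are Sylow in the preimage of `⟨u⟩`, so `b * g`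
  -- normalises the cyclic group `R` and acts on it as a power map with exponent `s`. As `f b`
  -- commutes with `u`, this map still inverts the image of `R`.
  obtain ⟨⟨b, hbB⟩, hb⟩ := MulAction.exists_smul_eq B ((g • R).subtype hgRB) (R.subtype hRB)
  rw [Sylow.smul_subtype] at hb
  have hbg : (b * g) • R = R := by
    rw [mul_smul]
    exact Sylow.subtype_injective hb
  have hmem : (b * g) * r * (b * g)⁻¹ ∈ R := by
    rw [← hbg, ← SetLike.mem_coe, Sylow.coe_smul]
    exact Set.smul_mem_smul_set (a := MulAut.conj (b * g)) hrR
  obtain ⟨s, hs⟩ := hr ⟨_, hmem⟩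
  have hs' : r ^ s = (b * g) * r * (b * g)⁻¹ := congrArg Subtype.val hs
  -- the action on `c` is trivial
  obtain ⟨i, hi⟩ := hr ⟨c, mem_sylow_of_mem_center hc hcp R⟩
  have hi' : r ^ i = c := congrArg Subtype.val hi
  have hcs : c ^ s = c := by
    rw [← hi', ← zpow_mul, mul_comm, zpow_mul, hs', conj_zpow, hi', Subgroup.mem_center_iff.1 hc,
      mul_inv_cancel_right]
  -- the action on `f r` is inversion
  obtain ⟨j, hj⟩ : f r ∈ Subgroup.zpowers u := hRB hrR
  have hj' : u ^ j = f r := hj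
  obtain ⟨l, hl⟩ : f b ∈ Subgroup.zpowers u := hbB
  have hl' : u ^ l = f b := hl
  have hfs : f r ^ s = (f r)⁻¹ := by
    rw [← map_zpow, hs', map_mul, map_mul, map_inv, map_mul, ← hl', ← hj']
    calc u ^ l * f g * u ^ j * (u ^ l * f g)⁻¹ = u ^ l * (f g * u ^ j * (f g)⁻¹) * (u ^ l)⁻¹ := by
          group
      _ = u ^ l * (u⁻¹) ^ j * (u ^ l)⁻¹ := by rw [← conj_zpow, hv]
      _ = (u ^ j)⁻¹ := by group
  have hfr1 : f r ≠ 1 := by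
    intro h
    have hle : (R : Subgroup G) ≤ f.ker := by
      intro y hy
      obtain ⟨k, hk⟩ := hr ⟨y, hy⟩
      have hk' : r ^ k = y := congrArg Subtype.val hk
      rw [MonoidHom.mem_ker, ← hk', map_zpow, h, one_zpow]
    rw [(Subgroup.map_eq_bot_iff _).2 hle, Subgroup.zpowers_eq_bot] at hQu
    exact hu1 hQu
  have hfrp : f r ^ p = 1 := by
    rw [← hj', ← zpow_natCast, ← zpow_mul, mul_comm, zpow_mul, zpow_natCast, hup, one_zpow]
  -- Inversion on the image gives `s ≡ -1` modulo `p`, while `s` acts trivially on `c`.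
  have hps : (p : ℤ) ∣ s + 1 := by
    rw [← orderOf_eq_prime hfrp hfr1, orderOf_dvd_iff_zpow_eq_one, zpow_add, zpow_one, hfs,
      inv_mul_cancel]
  obtain ⟨m, hm⟩ := hps
  have h1 : c ^ (s + 1) = 1 := by
    rw [hm, zpow_mul, zpow_natCast, hcp, one_zpow]
  rwa [zpow_add, hcs, zpow_one, ← sq] at h1

/-- `G` maps onto the central quotient of `G / M`, a copy of `PGL₂(3)` of order 24, where an element
of order 3 is inverted. A central `c` with `c ^ 3 = 1` then also has `c ^ 2 = 1`. -/
theorem not_three_dvd_card_K_of_tildeGL {G : Type*} [Group G] [Finite G] (M : Subgroup G)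
    [M.Normal] (hM : IsTildeGL23 (G ⧸ M)) : ¬ 3 ∣ Nat.card (K G) := by
  intro h
  obtain ⟨c, hc, hc1, hc3, hcu⟩ := prime_dvd_card_K_iff.1 h
  obtain ⟨-, ⟨φ, -, -⟩, -⟩ := hM
  obtain ⟨u, v, hu1, hu3, hv⟩ := exists_inverted_PGL
  have hfac : (24 : ℕ).factorization 3 = 1 := by
    rw [show 24 = 3 * 8 by norm_num, Nat.factorization_mul (by norm_num) (by norm_num),
      Finsupp.add_apply, Nat.Prime.factorization_self Nat.prime_three,
      Nat.factorization_eq_zero_of_not_dvd (by norm_num)]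
  have h2 := sq_eq_one_of_inverted (p := 3)
    (φ.toMonoidHom.comp ((QuotientGroup.mk' _).comp (QuotientGroup.mk' M)))
    (φ.surjective.comp ((QuotientGroup.mk'_surjective _).comp (QuotientGroup.mk'_surjective M)))
    (by rw [card_PGL_two_three, hfac]) hu1 hu3 hv hc hc3 fun R =>
      (sylow_isCyclic_or_isGeneralizedQuaternion hc3 hcu R).resolve_right (by norm_num)
  apply hc1
  rw [pow_succ, h2, one_mul] at hc3
  exact hc3

end EnhancedPower

/-! ### The main theorem. -/

theorem theoremA {G : Type*} [Group G] [Finite G] [Group.IsSolvable G] (p : ℕ) [Fact p.Prime]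
    (P : Sylow p G) :
    (p ∣ Nat.card (EnhancedPower.K G) ↔
      (IsCyclic P ∧ Subgroup.center G ⊓ (P : Subgroup G) ≠ ⊥) ∨
      (p = 2 ∧
        (EnhancedPower.QuaternionWithComplement (P : Subgroup G) ∨
          EnhancedPower.ExceptionalQuotient (P : Subgroup G)))) ∧
    (p = 2 → EnhancedPower.ExceptionalQuotient (P : Subgroup G) →
      3 ∣ Nat.card (EnhancedPower.K G) →
      Nonempty (G ⧸ EnhancedPower.pPrimeCore 2 G ≃*
        Matrix.SpecialLinearGroup (Fin 2) (ZMod 3))) ∧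
    (p = 2 →
      EnhancedPower.QuaternionWithComplement (P : Subgroup G) ∨
        EnhancedPower.ExceptionalQuotient (P : Subgroup G) →
      2 ^ (Nat.card (EnhancedPower.K G)).factorization 2 = 2) := by
  refine ⟨⟨fun h => ?_, ?_⟩, ?_, ?_⟩
  · obtain ⟨x, hxc, hx1, hxp, hxu⟩ := EnhancedPower.prime_dvd_card_K_iff.1 h
    rcases EnhancedPower.sylow_isCyclic_or_isGeneralizedQuaternion hxp hxu P with hP | ⟨rfl, hP⟩
    · refine Or.inl ⟨hP, fun hbot => hx1 ?_⟩
      rw [← Subgroup.mem_bot, ← hbot]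
      exact ⟨hxc, EnhancedPower.mem_sylow_of_mem_center hxc hxp P⟩
    · exact Or.inr ⟨rfl, EnhancedPower.quaternion_cases P hP hxc hxu⟩
  · rintro (⟨hcyc, hne⟩ | ⟨rfl, h⟩)
    · obtain ⟨⟨x, hxI⟩, hx⟩ := exists_prime_orderOf_dvd_card'
        (G := (Subgroup.center G ⊓ (P : Subgroup G) : Subgroup G)) p
        ((P.isPGroup'.to_inf_right.card_eq_or_dvd).resolve_left
          fun h => hne (Subgroup.card_eq_one.1 h))
      rw [Subgroup.orderOf_mk] at hx
      obtain ⟨hxc, hxP⟩ := Subgroup.mem_inf.1 hxI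
      have hxp : x ^ p = 1 := orderOf_dvd_iff_pow_eq_one.1 hx.dvd
      have hx1 : x ≠ 1 := by
        rintro rfl
        rw [orderOf_one] at hx
        exact (Fact.out : p.Prime).one_lt.ne hx
      refine EnhancedPower.prime_dvd_card_K_iff.2 ⟨x, hxc, hx1, hxp, fun y hy => ?_⟩
      -- A conjugate of `y` lies in the cyclic group `P` and is a power of `x`; as `x` is central,
      -- `y` is the same power.
      obtain ⟨g, hg⟩ := EnhancedPower.exists_conj_mem_sylow hy P
      obtain ⟨k, hk⟩ := EnhancedPower.mem_zpowers_of_isCyclic_of_pow_eq_one (C := P) (p := p) (x := ⟨x, hxP⟩)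
        (y := ⟨_, hg⟩) (Subtype.ext hxp) (fun h => hx1 (congrArg Subtype.val h))
        (Subtype.ext (by
          change (g * y * g⁻¹) ^ p = 1
          rw [conj_pow, hy, mul_one, mul_inv_cancel]))
      have hk' : x ^ k = g * y * g⁻¹ := congrArg Subtype.val hk
      refine ⟨k, ?_⟩
      change x ^ k = y
      have hc := Subgroup.mem_center_iff.1 ((Subgroup.center G).zpow_mem hxc k) g
      rw [eq_mul_inv_iff_mul_eq, ← hc] at hk'
      exact mul_left_cancel hk'
    · obtain ⟨z, hzc, hz1, hz2, hzu, -⟩ := EnhancedPower.exists_central_involution_of_cases P h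
      exact EnhancedPower.prime_dvd_card_K_iff.2 ⟨z, hzc, hz1, hz2, fun y hy => by
        rcases hzu y hy with rfl | rfl
        · exact Subgroup.one_mem _
        · exact Subgroup.mem_zpowers _⟩
  · rintro rfl ⟨-, h | h⟩ h3
    · exact h
    · exact absurd h3 (EnhancedPower.not_three_dvd_card_K_of_tildeGL _ h)
  · rintro rfl h
    obtain ⟨z, hzc, hz1, hz2, hzu, hz4⟩ := EnhancedPower.exists_central_involution_of_cases P h
    exact EnhancedPower.two_pow_factorization_card_K hzc hz1 hz2 hzu hz4
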